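/- Let $X\subset\mathbb P^3=\mathbb P^3(\mathbb C)$ be an irreducible Zariski-closed algebraic curve that is not a line. Let $X^*\subset\mathbb P^{3*}$ be its dual variety, i.e. the Zariski closure of the set of planes that contain the tangent line of $X$ at some smooth point of $X$. Then $X^*$ is a hypersurface, i.e. it is the zero set of some nonzero homogeneous polynomial; let $\Upsilon$ be any nonzero homogeneous polynomial of minimal degree whose zero set is $X^*$. There is an integer $m$, depending only on $X$, and a nonempty Zariski-open set $U\subset\mathbb P^3$ such that for every centre $O\in U$ one has $O\notin X$ and, for every projection $\pi:\mathbb P^3\setminus\{O\}\to\mathbb P^2$ with centre $O$ (given by a $3\times 4$ complex matrix with kernel $O$), the image $\pi(X)$ is an irreducible closed plane curve of class $m$. Here the class of a plane curve $Y$ is the degree of its dual curve $Y^*\subset\mathbb P^{2*}$ (the Zariski closure of the set of tangent lines at smooth points of $Y$), i.e. the least degree of a nonzero homogeneous polynomial with zero set $Y^*$. Moreover $$\deg\Upsilon=m .$$ In particular the class of the projection of $X$ is constant for generic centres. -/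

import Mathlib

noncomputable section

namespace SpaceCurve

/-- Complex projective space `ℙⁿ`, with homogeneous coordinates indexed by `Fin (n + 1)`. A point of
the dual space `ℙⁿ*` is written by the coefficients `a` of the hyperplane `∑ aᵢ xᵢ = 0`. -/
abbrev PSpace (n : ℕ) : Type := Projectivization ℂ (Fin (n + 1) → ℂ)

/-- The (punctured) affine cone over a subset of `ℙⁿ`. -/
def cone {n : ℕ} (S : Set (PSpace n)) : Set (Fin (n + 1) → ℂ) :=
  {v | ∃ h : v ≠ 0, Projectivization.mk ℂ v h ∈ S}

/-- The homogeneous ideal of a subset of `ℙⁿ`: all polynomials that vanish on its cone. (As the cone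
is stable under scaling and `ℂ` is infinite, this ideal is generated by homogeneous polynomials.) -/
def idealOf {n : ℕ} (S : Set (PSpace n)) : Ideal (MvPolynomial (Fin (n + 1)) ℂ) :=
  MvPolynomial.vanishingIdeal ℂ (cone S)

/-- The Zariski closure of a subset of `ℙⁿ`. -/
def zariskiClosure {n : ℕ} (S : Set (PSpace n)) : Set (PSpace n) :=
  {p | ∀ f ∈ idealOf S, MvPolynomial.eval p.rep f = 0}

/-- The Krull dimension of the homogeneous coordinate ring of `X`, that is `dim X + 1`. -/
def coneDim {n : ℕ} (X : Set (PSpace n)) : WithBot ℕ∞ :=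
  ringKrullDim (MvPolynomial (Fin (n + 1)) ℂ ⧸ idealOf X)

/-- `X ⊆ ℙⁿ` is an irreducible Zariski-closed algebraic curve. -/
structure IsIrreducibleCurve {n : ℕ} (X : Set (PSpace n)) : Prop where
  closed : zariskiClosure X = X
  irreducible : (idealOf X).IsPrime
  dim_eq_one : coneDim X = 2

/-- `X ⊆ ℙⁿ` is a (projective) line. -/
def IsLine {n : ℕ} (X : Set (PSpace n)) : Prop :=
  ∃ L : Submodule ℂ (Fin (n + 1) → ℂ), Module.finrank ℂ L = 2 ∧ X = {p | p.submodule ≤ L}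

/-- The embedded projective tangent space of `X` at `p`, as a linear subspace of `ℂⁿ⁺¹`. -/
def tangentSpace {n : ℕ} (X : Set (PSpace n)) (p : PSpace n) :
    Submodule ℂ (Fin (n + 1) → ℂ) where
  carrier := {w | ∀ f ∈ idealOf X, ∑ i, MvPolynomial.eval p.rep (MvPolynomial.pderiv i f) * w i = 0}
  add_mem' := by
    intro a b ha hb f hf
    simp only [Pi.add_apply, mul_add, Finset.sum_add_distrib, ha f hf, hb f hf, add_zero]
  zero_mem' := by
    intro f _
    simp
  smul_mem' := by
    intro c a ha f hf
    have h := ha f hf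
    simp only [Pi.smul_apply, smul_eq_mul, mul_left_comm _ c, ← Finset.mul_sum, h, mul_zero]

/-- `p` is a smooth point of the irreducible variety `X`: the tangent space has the dimension
of `X`. -/
def IsSmoothPoint {n : ℕ} (X : Set (PSpace n)) (p : PSpace n) : Prop :=
  p ∈ X ∧ ((Module.finrank ℂ (tangentSpace X p) : ℕ) : WithBot ℕ∞) = coneDim X

/-- The hyperplane with coefficients `a` contains the tangent space of `X` at `p`. -/
def IsTangentAt {n : ℕ} (X : Set (PSpace n)) (p : PSpace n) (a : PSpace n) : Prop :=
  ∀ w ∈ tangentSpace X p, ∑ i, a.rep i * w i = 0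

/-- The dual variety `X* ⊆ ℙⁿ*`: the Zariski closure of the set of hyperplanes that are tangent to
`X` at some smooth point of `X`. -/
def dualVariety {n : ℕ} (X : Set (PSpace n)) : Set (PSpace n) :=
  zariskiClosure {a | ∃ p, IsSmoothPoint X p ∧ IsTangentAt X p a}

/-- `F` is a nonzero homogeneous polynomial whose zero set in `ℙⁿ` is `S`. -/
def Represents {n : ℕ} (F : MvPolynomial (Fin (n + 1)) ℂ) (S : Set (PSpace n)) : Prop :=
  F ≠ 0 ∧ F.IsHomogeneous F.totalDegree ∧ S = {p | MvPolynomial.eval p.rep F = 0}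

/-- `F` is a polynomial of minimal degree that represents the hypersurface `S`. -/
def IsMinimalEquation {n : ℕ} (F : MvPolynomial (Fin (n + 1)) ℂ) (S : Set (PSpace n)) : Prop :=
  Represents F S ∧ ∀ G, Represents G S → F.totalDegree ≤ G.totalDegree

/-- The plane curve `Y` has class `m`: its dual `Y*` is a curve of degree `m`, that is, it has a
minimal equation of degree `m`. -/
def HasClass (Y : Set (PSpace 2)) (m : ℕ) : Prop :=
  ∃ φ : MvPolynomial (Fin 3) ℂ, IsMinimalEquation φ (dualVariety Y) ∧ φ.totalDegree = m

/-- The image of `X` under the projection `p ↦ M p`; points where `M p = 0` have no image. -/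
def projection (M : Matrix (Fin 3) (Fin 4) ℂ) (X : Set (PSpace 3)) : Set (PSpace 2) :=
  {q | ∃ p ∈ X, ∃ h : M.mulVec p.rep ≠ 0, q = Projectivization.mk ℂ (M.mulVec p.rep) h}

/-- `M` is the matrix of a projection with centre `O`: its kernel is exactly `O`. -/
def HasCentre (M : Matrix (Fin 3) (Fin 4) ℂ) (O : PSpace 3) : Prop :=
  LinearMap.ker M.mulVecLin = O.submodule

/-- `P` holds for a generic point of `ℙⁿ`: on a nonempty Zariski-open subset, which is given here as
(or contains) the complement of a hypersurface. -/
def HoldsGenerically {n : ℕ} (P : PSpace n → Prop) : Prop :=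
  ∃ G : MvPolynomial (Fin (n + 1)) ℂ, G ≠ 0 ∧ G.IsHomogeneous G.totalDegree ∧
    ∀ p : PSpace n, MvPolynomial.eval p.rep G ≠ 0 → P p

end SpaceCurve

end

/-! Let `K` be the function field of the affine cone over X, of transcendence degree 2 over ℂ, and
let `ξ` be the generic point of the cone. The conormal space N, the `K`-span of the gradients at `ξ`
of the equations of X, has dimension n - 1, because its orthogonal complement is the space of
ℂ-derivations from the coordinate ring to `K`, and in characteristic zero this has dimension 2. The
ideal of X* consists of the complex polynomials that vanish on N (`idealOf_dualVariety`). Questions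
about duals thus become linear algebra over `K`.

This ideal is prime. It is nonzero because N does not notice a rescaling of the point, so that one
dimension is lost (`vanishingOn_conormal_ne_bot`). It is principal unless N has a basis over ℂ
(`exists_generator_or_exists_complex_basis`). In that case Euler's identity turns the basis into n -
1 linear equations of X, and X is a line. A generator Υ is a minimal equation.

For a generic centre O, the conormal line of the projected curve corresponds to the elements of N
that are orthogonal to O (`mem_conormal_projection_iff`). Hence Υ, restricted to the plane of all
hyperplanes through O, is a multiple of the equation of the dual of the projection, and the class is
at most deg Υ. Equality means that no nonzero form of smaller degree on that plane vanishes on its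
intersection with N. This is proved without Bertini: independence of the monomials of degree deg Υ -
1 at the intersection point is an open condition on O, and it is tested on a pencil of planes with
parameter t. A relation with coefficients polynomial in t homogenizes to an element of the ideal of
N whose degree in the first variable is below that of Υ, so it is zero (`eq_zero_of_forall_pencil`).
-/

namespace SpaceCurve

open MvPolynomial

section

open TensorProduct

/-! ### Dimension theory of finitely generated domains -/

/-- Going up lifts chains of primes from `R` to `S`; incomparability keeps chains of `S` strict
after contraction. -/
theorem ringKrullDim_eq_of_injective_of_isIntegral (R S : Type*) [CommRing R] [CommRing S]
    [Algebra R S] [Algebra.IsIntegral R S] (h : Function.Injective (algebraMap R S)) :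
    ringKrullDim R = ringKrullDim S := by
  refine le_antisymm (iSup_le fun l => ?_)
    (Order.krullDim_le_of_strictMono (PrimeSpectrum.comap (algebraMap R S)) fun P Q hPQ =>
      Ideal.IsIntegral.comap_lt_comap hPQ)
  obtain ⟨P, -, hP, hPl⟩ := Ideal.exists_ideal_over_prime_of_isIntegral (S := S)
    l.head.asIdeal ⊥ (by
      rw [← RingHom.ker_eq_comap_bot, (RingHom.injective_iff_ker_eq_bot _).1 h]
      exact bot_le)
  have : P.LiesOver (RelSeries.head l).asIdeal := ⟨hPl.symm⟩
  obtain ⟨L, hL, -⟩ := Ideal.exists_ltSeries_of_hasGoingUp l P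
  rw [← hL]
  exact le_iSup (fun p : LTSeries (PrimeSpectrum S) => (p.length : WithBot ℕ∞)) L

/-- By Noether normalization both invariants are the number of variables of a polynomial subring
over which `R` is integral. -/
theorem exists_ringKrullDim_eq_and_trdeg_eq (k R : Type) [Field k] [CommRing R] [IsDomain R]
    [Algebra k R] [Algebra.FiniteType k R] :
    ∃ s : ℕ, ringKrullDim R = s ∧ Algebra.trdeg k R = s := by
  obtain ⟨s, g, hg, hint⟩ := exists_integral_inj_algHom_of_fg k R
  let : Algebra (MvPolynomial (Fin s) k) R := g.toRingHom.toAlgebra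
  have : IsScalarTower k (MvPolynomial (Fin s) k) R :=
    .of_algebraMap_eq fun x => (g.commutes x).symm
  have : Algebra.IsIntegral (MvPolynomial (Fin s) k) R := ⟨hint⟩
  have : FaithfulSMul (MvPolynomial (Fin s) k) R :=
    (faithfulSMul_iff_algebraMap_injective _ _).2 hg
  refine ⟨s, ?_, ?_⟩
  · rw [← ringKrullDim_eq_of_injective_of_isIntegral (MvPolynomial (Fin s) k) R hg,
      MvPolynomial.ringKrullDim_of_isNoetherianRing, ringKrullDim_eq_zero_of_field]
    simp
  · rw [← trdeg_add_eq k (MvPolynomial (Fin s) k), MvPolynomial.trdeg_of_isDomain,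
      trdeg_eq_zero]
    simp

theorem trdeg_eq_of_ringKrullDim_eq (k R : Type) [Field k] [CommRing R] [IsDomain R]
    [Algebra k R] [Algebra.FiniteType k R] {d : ℕ} (h : ringKrullDim R = d) :
    Algebra.trdeg k R = d := by
  obtain ⟨s, h1, h2⟩ := exists_ringKrullDim_eq_and_trdeg_eq k R
  rw [h1] at h
  rw [h2, Nat.cast_inj.1 (show ((s : ℕ) : WithBot ℕ∞) = (d : ℕ) from h)]

/-! ### Differentials of a field of finite transcendence degree -/

/-- A localization followed by an algebraic field extension, which is separable in characteristic
zero. -/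
theorem formallyEtale_of_isAlgebraic (A K : Type) [CommRing A] [IsDomain A] [CharZero A] [Field K]
    [Algebra A K] [FaithfulSMul A K] [Algebra.IsAlgebraic A K] : Algebra.FormallyEtale A K := by
  let : Algebra (FractionRing A) K := FractionRing.liftAlgebra A K
  have : IsScalarTower A (FractionRing A) K := FractionRing.isScalarTower_liftAlgebra A K
  have : Algebra.IsAlgebraic (FractionRing A) K :=
    (IsFractionRing.comap_isAlgebraic_iff (A := A) (K := FractionRing A)).1 inferInstance
  have : CharZero (FractionRing A) := IsFractionRing.charZero A
  have : Algebra.FormallyEtale A (FractionRing A) := .of_isLocalization (nonZeroDivisors A)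
  have : Algebra.FormallyEtale (FractionRing A) K := .of_isSeparable _ _
  exact .comp A (FractionRing A) K

/-- A transcendence basis makes `K` formally étale over a polynomial ring, so the differentials of
that ring become those of `K` after base change. -/
theorem finrank_kaehlerDifferential_eq {K : Type} [Field K] [Algebra ℂ K] {d : ℕ}
    (hK : Algebra.trdeg ℂ K = d) : Module.finrank K (Ω[K⁄ℂ]) = d := by
  obtain ⟨ι, s, hs⟩ := exists_isTranscendenceBasis' ℂ K
  have hcard : Cardinal.mk ι = d := by rw [hs.cardinalMk_eq_trdeg, hK]
  let : Algebra (MvPolynomial ι ℂ) K := (aeval s).toRingHom.toAlgebra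
  have : IsScalarTower ℂ (MvPolynomial ι ℂ) K :=
    .of_algebraMap_eq fun x => ((aeval (R := ℂ) s).commutes x).symm
  have : FaithfulSMul (MvPolynomial ι ℂ) K :=
    (faithfulSMul_iff_algebraMap_injective _ _).2 hs.1
  have : Algebra.IsAlgebraic (MvPolynomial ι ℂ) K := by
    have := hs.isAlgebraic
    refine ⟨fun x => ?_⟩
    obtain ⟨p, hp, hx⟩ := this.isAlgebraic x
    refine ⟨p.map hs.1.aevalEquiv.symm.toRingHom, ?_, ?_⟩
    · rwa [Ne, Polynomial.map_eq_zero_iff]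
      exact hs.1.aevalEquiv.symm.injective
    · rw [← hx, Polynomial.aeval_def, Polynomial.eval₂_map, Polynomial.aeval_def]
      congr 1
      ext y
      obtain ⟨z, rfl⟩ := hs.1.aevalEquiv.surjective y
      simp only [RingEquiv.toRingHom_eq_coe, RingHom.coe_comp,
        RingHom.coe_coe, Function.comp_apply, AlgEquiv.coe_ringEquiv, AlgEquiv.symm_apply_apply]
      rw [AlgebraicIndependent.algebraMap_aevalEquiv]
      rfl
  have : Algebra.FormallyEtale (MvPolynomial ι ℂ) K := formallyEtale_of_isAlgebraic _ _
  rw [← (KaehlerDifferential.tensorKaehlerEquivOfFormallyEtale ℂ (MvPolynomial ι ℂ) K).finrank_eq,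
    Module.finrank_eq_nat_card_basis
      ((KaehlerDifferential.mvPolynomialBasis ℂ ι).baseChange K), Nat.card, hcard]
  simp

/-! ### The tangent space at a generic point -/

/-- `ξ` is a generic point (with coordinates in an extension of `ℂ`) of the zero set of `I`. -/
def IsGenericPoint {n : ℕ} {K : Type} [Field K] [Algebra ℂ K]
    (I : Ideal (MvPolynomial (Fin (n + 1)) ℂ)) (ξ : Fin (n + 1) → K) : Prop :=
  ∀ f, f ∈ I ↔ aeval ξ f = 0

/-- The gradient of `h` at `ξ`. -/
noncomputable def grad {n : ℕ} {K : Type} [Field K] [Algebra ℂ K] (ξ : Fin (n + 1) → K)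
    (h : MvPolynomial (Fin (n + 1)) ℂ) : Fin (n + 1) → K :=
  fun i => aeval ξ (pderiv i h)

/-- The span of the gradients at `ξ` of the elements of `I`. -/
noncomputable def conormal {n : ℕ} {K : Type} [Field K] [Algebra ℂ K]
    (I : Ideal (MvPolynomial (Fin (n + 1)) ℂ)) (ξ : Fin (n + 1) → K) :
    Submodule K (Fin (n + 1) → K) :=
  Submodule.span K (grad ξ '' I)

/-- The orthogonal complement for the standard bilinear form. -/
noncomputable def perp {K : Type} [Field K] {n : ℕ} (N : Submodule K (Fin n → K)) :
    Submodule K (Fin n → K) where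
  carrier := {w | ∀ a ∈ N, a ⬝ᵥ w = 0}
  add_mem' := by
    intro v w hv hw a ha
    rw [dotProduct_add, hv a ha, hw a ha, add_zero]
  zero_mem' := fun a _ => dotProduct_zero a
  smul_mem' := by
    intro c v hv a ha
    rw [dotProduct_smul, hv a ha, smul_zero]

theorem mem_perp {K : Type} [Field K] {n : ℕ} {N : Submodule K (Fin n → K)} {w : Fin n → K} :
    w ∈ perp N ↔ ∀ a ∈ N, a ⬝ᵥ w = 0 := Iff.rfl

theorem mem_perp_span {K : Type} [Field K] {n : ℕ} {s : Set (Fin n → K)} {w : Fin n → K} :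
    w ∈ perp (Submodule.span K s) ↔ ∀ a ∈ s, a ⬝ᵥ w = 0 := by
  refine ⟨fun h a ha => h a (Submodule.subset_span ha), fun h a ha => ?_⟩
  induction ha using Submodule.span_induction with
  | mem a ha => exact h a ha
  | zero => exact zero_dotProduct w
  | add a b _ _ ha hb => rw [add_dotProduct, ha, hb, add_zero]
  | smul c a _ ha => rw [smul_dotProduct, ha, smul_zero]

theorem finrank_perp {K : Type} [Field K] {n : ℕ} (N : Submodule K (Fin n → K)) :
    Module.finrank K N + Module.finrank K (perp N) = n := by
  have h : perp N = (N.map (dotProductEquiv K (Fin n)).toLinearMap).dualCoannihilator := by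
    ext w
    rw [mem_perp, Submodule.mem_dualCoannihilator]
    constructor
    · rintro hw _ ⟨a, ha, rfl⟩
      exact hw a ha
    · exact fun hw a ha => hw _ ⟨a, ha, rfl⟩
  have h2 := Subspace.finrank_add_finrank_dualCoannihilator_eq
    (N.map (dotProductEquiv K (Fin n)).toLinearMap)
  rw [← h, LinearEquiv.finrank_map_eq] at h2
  simpa using h2

theorem perp_perp {K : Type} [Field K] {n : ℕ} (N : Submodule K (Fin n → K)) :
    perp (perp N) = N := by
  symm
  apply Submodule.eq_of_le_of_finrank_eq
  · intro a ha w hw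
    rw [dotProduct_comm]
    exact hw a ha
  · have h1 := finrank_perp N
    have h2 := finrank_perp (perp N)
    omega

/-- A vector orthogonal to all gradients is the same as a derivation of the coordinate ring `R` into
`K`, that is, a linear map from `Ω[R⁄ℂ]` to `K`. Equal transcendence degrees make `K` algebraic over
`R`, hence formally étale, so `Ω[R⁄ℂ]` becomes `Ω[K⁄ℂ]` over `K`. -/
theorem finrank_perp_conormal {n : ℕ} {K : Type} [Field K] [Algebra ℂ K]
    {I : Ideal (MvPolynomial (Fin (n + 1)) ℂ)} [I.IsPrime] {ξ : Fin (n + 1) → K}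
    (hξ : IsGenericPoint I ξ) {d : ℕ} (hK : Algebra.trdeg ℂ K = d)
    (hI : ringKrullDim (MvPolynomial (Fin (n + 1)) ℂ ⧸ I) = d) :
    Module.finrank K (perp (conormal I ξ)) = d := by
  let R := MvPolynomial (Fin (n + 1)) ℂ ⧸ I
  let φ : R →ₐ[ℂ] K := Ideal.Quotient.liftₐ I (aeval ξ) fun f hf => (hξ f).1 hf
  have hφ : Function.Injective φ := by
    rw [injective_iff_map_eq_zero]
    intro x hx
    obtain ⟨f, rfl⟩ := Ideal.Quotient.mk_surjective x
    exact Ideal.Quotient.eq_zero_iff_mem.2 ((hξ f).2 hx)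
  let : Algebra R K := φ.toRingHom.toAlgebra
  have : IsScalarTower ℂ R K := .of_algebraMap_eq fun x => (φ.commutes x).symm
  have : FaithfulSMul R K := (faithfulSMul_iff_algebraMap_injective _ _).2 hφ
  have hR : Algebra.trdeg ℂ R = d := trdeg_eq_of_ringKrullDim_eq ℂ R hI
  have : Algebra.IsAlgebraic R K := by
    rw [← trdeg_eq_zero_iff]
    have h := trdeg_add_eq ℂ R (A := K)
    rw [hR, hK] at h
    exact Cardinal.eq_of_add_eq_add_left (h.trans (add_zero _).symm) (Cardinal.natCast_lt_aleph0)
  have : CharZero R := algebraRat.charZero R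
  have : Algebra.FormallyEtale R K := formallyEtale_of_isAlgebraic _ _
  let : Algebra (MvPolynomial (Fin (n + 1)) ℂ) K := (aeval (R := ℂ) ξ).toRingHom.toAlgebra
  have : IsScalarTower (MvPolynomial (Fin (n + 1)) ℂ) R K :=
    IsScalarTower.of_algebraMap_eq (R := MvPolynomial (Fin (n + 1)) ℂ) (S := R) (A := K)
      fun _ => rfl
  have : IsScalarTower ℂ (MvPolynomial (Fin (n + 1)) ℂ) K :=
    .of_algebraMap_eq fun x => ((aeval (R := ℂ) ξ).commutes x).symm
  have hder : ∀ (δ : Derivation ℂ (MvPolynomial (Fin (n + 1)) ℂ) K) f,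
      δ f = grad ξ f ⬝ᵥ fun i => δ (X i) := by
    intro δ f
    induction f using MvPolynomial.induction_on with
    | C a =>
      rw [← MvPolynomial.algebraMap_eq, Derivation.map_algebraMap]
      simp [grad, dotProduct]
    | add p q hp hq => 
      rw [map_add, hp, hq, ← add_dotProduct]
      congr 1
      ext i
      simp [grad]
    | mul_X p j hp =>
      have h1 : grad ξ (p * X j) = ξ j • grad ξ p + aeval ξ p • Pi.single j 1 := by
        ext i
        by_cases hij : i = j
        · subst hij
          simp [grad, Derivation.leibniz]
          ring
        · simp [grad, Derivation.leibniz, pderiv_X_of_ne (Ne.symm hij), hij]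
      rw [h1, Derivation.leibniz, hp, add_dotProduct, smul_dotProduct, smul_dotProduct,
        single_dotProduct, one_mul, add_comm, Algebra.smul_def, Algebra.smul_def]
      congr 2
      exact aeval_X ξ j
  let x : Fin (n + 1) → R := fun i => Ideal.Quotient.mk I (X i)
  let Φ : (Ω[R⁄ℂ] →ₗ[R] K) →ₗ[K] (Fin (n + 1) → K) :=
    { toFun := fun l i => l (KaehlerDifferential.D ℂ R (x i))
      map_add' := fun _ _ => rfl
      map_smul' := fun _ _ => rfl }
  have hD : ∀ (l : Ω[R⁄ℂ] →ₗ[R] K) f, l (KaehlerDifferential.D ℂ R (Ideal.Quotient.mk I f)) =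
      grad ξ f ⬝ᵥ Φ l := by
    intro l f
    exact hder ((l.compDer (KaehlerDifferential.D ℂ R)).compAlgebraMap _) f
  have hinj : Function.Injective Φ := by
    rw [injective_iff_map_eq_zero]
    intro l hl
    apply LinearMap.ext_on (KaehlerDifferential.span_range_derivation ℂ R)
    rintro _ ⟨y, rfl⟩
    obtain ⟨f, rfl⟩ := Ideal.Quotient.mk_surjective y
    rw [hD, hl, dotProduct_zero, LinearMap.zero_apply]
  have hrange : LinearMap.range Φ = perp (conormal I ξ) := by
    ext w
    rw [conormal, mem_perp_span]
    constructor
    · rintro ⟨l, rfl⟩ _ ⟨f, hf, rfl⟩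
      rw [← hD, Ideal.Quotient.eq_zero_iff_mem.2 hf, map_zero, map_zero]
    · intro hw
      let δ := mkDerivation ℂ w
      have hδ : ∀ f, δ f = grad ξ f ⬝ᵥ w := fun f => by
        rw [hder]
        congr 1
        ext i
        exact mkDerivation_X ℂ w i
      have hδI : ∀ f g, Ideal.Quotient.mk I f = Ideal.Quotient.mk I g → δ f = δ g := by
        intro f g hfg
        rw [← sub_eq_zero, ← map_sub, hδ]
        exact hw _ ⟨f - g, Ideal.Quotient.eq.1 hfg, rfl⟩
      -- A set-theoretic section is enough: by `hδI` the value of `δ` depends only on the class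
      -- modulo `I`.
      let σ : R → MvPolynomial (Fin (n + 1)) ℂ :=
        Function.surjInv (Ideal.Quotient.mk_surjective (I := I))
      have hσ : ∀ r, Ideal.Quotient.mk I (σ r) = r := Function.surjInv_eq _
      let L : R →ₗ[ℂ] K :=
        { toFun := fun r => δ (σ r)
          map_add' := fun a b => by
            rw [← map_add]
            apply hδI
            rw [map_add, hσ, hσ, hσ]
          map_smul' := fun c a => by
            rw [RingHom.id_apply, ← Derivation.map_smul]
            apply hδI
            rw [← Ideal.Quotient.mkₐ_eq_mk ℂ, map_smul, Ideal.Quotient.mkₐ_eq_mk, hσ, hσ] }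
      let d : Derivation ℂ R K := Derivation.mk' L fun a b => by
        change δ (σ (a * b)) = a • δ (σ b) + b • δ (σ a)
        have h1 : δ (σ (a * b)) = δ (σ a * σ b) := by
          apply hδI
          rw [map_mul, hσ, hσ, hσ]
        rw [h1, Derivation.leibniz]
        congr 1
        · conv_rhs => rw [← hσ a]
          exact (algebraMap_smul R (σ a) (δ (σ b))).symm
        · conv_rhs => rw [← hσ b]
          exact (algebraMap_smul R (σ b) (δ (σ a))).symm
      refine ⟨d.liftKaehlerDifferential, ?_⟩
      ext i
      change d.liftKaehlerDifferential (KaehlerDifferential.D ℂ R (x i)) = w i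
      rw [Derivation.liftKaehlerDifferential_comp_D]
      change δ (σ (x i)) = w i
      rw [← mkDerivation_X ℂ w i]
      exact hδI _ _ (hσ _)
  rw [← hrange, LinearMap.finrank_range_of_inj hinj,
    (LinearMap.liftBaseChangeEquiv (R := R) (M := Ω[R⁄ℂ]) (N := K) K).finrank_eq]
  rw [← finrank_kaehlerDifferential_eq hK,
    ← (KaehlerDifferential.tensorKaehlerEquivOfFormallyEtale ℂ R K).finrank_eq]
  exact Subspace.dual_finrank_eq

end

section

/-! ### Minors -/

/-- If every minor of size r + 1 vanished, Laplace expansion along an arbitrary added column would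
be a dependence relation; its coefficients are cofactors, the first of which is a nonzero minor of
size r. The index type may be infinite: later it is a space of linear functionals. -/
theorem exists_minor_ne_zero {A ι : Type*} [CommRing A] [IsDomain A] {r : ℕ} (F : Fin r → ι → A)
    (hF : LinearIndependent A F) :
    ∃ c : Fin r → ι, (Matrix.of fun i j => F i (c j)).det ≠ 0 := by
  induction r with
  | zero => exact ⟨Fin.elim0, by simp⟩
  | succ r ih =>
    obtain ⟨c, hc⟩ := ih (fun i => F i.succ) (hF.comp _ (Fin.succ_injective r))
    by_contra! h
    let g : Fin (r + 1) → A := fun i =>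
      (-1) ^ (i : ℕ) * (Matrix.of fun k j => F (i.succAbove k) (c j)).det
    have hg : ∑ i, g i • F i = 0 := by
      ext j
      rw [Finset.sum_apply, Pi.zero_apply, ← h (Fin.cons j c), Matrix.det_succ_column_zero]
      refine Finset.sum_congr rfl fun i _ => ?_
      simp only [g, Pi.smul_apply, smul_eq_mul, Matrix.of_apply, Fin.cons_zero]
      rw [mul_right_comm]
      rfl
    have h0 := Fintype.linearIndependent_iff.1 hF g hg 0
    apply hc
    simpa [g] using h0

theorem linearIndependent_of_minor_ne_zero {K ι : Type*} [Field K] {r : ℕ} (F : Fin r → ι → K)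
    (c : Fin r → ι) (h : (Matrix.of fun i j => F i (c j)).det ≠ 0) : LinearIndependent K F := by
  have h1 := Matrix.linearIndependent_rows_of_det_ne_zero h
  exact LinearIndependent.of_comp (LinearMap.funLeft K K c) h1

/-! ### Polynomials vanishing on a linear subspace over an extension field -/

theorem polynomial_eq_zero_of_eval {K : Type*} [Field K] [Algebra ℂ K] (p : Polynomial K)
    (h : ∀ t : ℂ, t ≠ 0 → p.eval (algebraMap ℂ K t) = 0) : p = 0 := by
  apply Polynomial.eq_zero_of_infinite_isRoot
  have h1 : ({0}ᶜ : Set ℂ).Infinite := (Set.finite_singleton 0).infinite_compl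
  refine (h1.image (f := algebraMap ℂ K) (algebraMap ℂ K).injective.injOn).mono ?_
  rintro _ ⟨t, ht, rfl⟩
  exact h t ht

variable {K : Type} [Field K] [Algebra ℂ K]

theorem aeval_smul_eq_sum {σ : Type*} (f : MvPolynomial σ ℂ) (a : σ → K) (t : K) :
    aeval (t • a) f =
      ∑ d ∈ Finset.range (f.totalDegree + 1), t ^ d * aeval a (homogeneousComponent d f) := by
  conv_lhs => rw [← sum_homogeneousComponent f, map_sum]
  refine Finset.sum_congr rfl fun d _ => ?_
  have hd := homogeneousComponent_isHomogeneous d f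
  rw [aeval_def, aeval_def, eval₂_eq, eval₂_eq, Finset.mul_sum]
  refine Finset.sum_congr rfl fun m hm => ?_
  have hm : m.degree = d := by
    by_contra h
    exact mem_support_iff.1 hm (hd.coeff_eq_zero h)
  simp only [Pi.smul_apply, smul_eq_mul, mul_pow, Finset.prod_mul_distrib,
    Finset.prod_pow_eq_pow_sum]
  rw [show ∑ i ∈ m.support, m i = d from hm]
  ring

theorem aeval_smul_of_isHomogeneous {σ : Type*} {f : MvPolynomial σ ℂ} {d : ℕ}
    (hf : f.IsHomogeneous d) (a : σ → K) (t : K) :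
    aeval (t • a) f = t ^ d * aeval a f := by
  by_cases h0 : f = 0
  · simp [h0]
  rw [aeval_smul_eq_sum, Finset.sum_eq_single d]
  · rw [homogeneousComponent_eq_self hf]
  · intro e _ he
    rw [homogeneousComponent_of_mem hf, if_neg he, map_zero, mul_zero]
  · intro h
    rw [hf.totalDegree h0] at h
    simp at h

/-- Along a line through the origin, f is a polynomial in t whose coefficients are the values of the
components; it has infinitely many zeros. -/
theorem aeval_homogeneousComponent_eq_zero {σ : Type*} {f : MvPolynomial σ ℂ} {a : σ → K}
    (h : ∀ t : ℂ, t ≠ 0 → aeval (algebraMap ℂ K t • a) f = 0) (d : ℕ) :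
    aeval a (homogeneousComponent d f) = 0 := by
  let p : Polynomial K := ∑ d ∈ Finset.range (f.totalDegree + 1),
    Polynomial.C (aeval a (homogeneousComponent d f)) * Polynomial.X ^ d
  have hp : p = 0 := polynomial_eq_zero_of_eval p fun t ht => by
    rw [← h t ht, aeval_smul_eq_sum, Polynomial.eval_finsetSum]
    exact Finset.sum_congr rfl fun d _ => by
      rw [Polynomial.eval_mul, Polynomial.eval_C, Polynomial.eval_pow, Polynomial.eval_X, mul_comm]
  by_cases hd : d < f.totalDegree + 1
  · have := congrArg (Polynomial.coeff · d) hp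
    simp only [p, Polynomial.finsetSum_coeff, Polynomial.coeff_C_mul, Polynomial.coeff_X_pow,
      mul_ite, mul_one, mul_zero, Finset.sum_ite_eq, Finset.mem_range, hd, if_true,
      Polynomial.coeff_zero] at this
    exact this
  · rw [homogeneousComponent_eq_zero _ _ (by omega), map_zero]

/-- The generic linear combination of the vectors `v j`. -/
noncomputable def genComb {σ ι : Type} [Fintype ι] (v : ι → σ → K) : σ → MvPolynomial ι K :=
  fun i => ∑ j, C (v j i) * X j

theorem eval_aeval_genComb {σ ι : Type} [Fintype ι] (v : ι → σ → K) (f : MvPolynomial σ ℂ)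
    (s : ι → K) : eval s (aeval (genComb v) f) = aeval (∑ j, s j • v j) f := by
  have h : ((aeval (R := K) s).restrictScalars ℂ).comp (aeval (genComb v)) =
      aeval (∑ j, s j • v j) := by
    ext i
    simp [genComb, mul_comm]
  rw [← h]
  simp [aeval_eq_eval]

/-- Presents the polynomials vanishing on a subspace as the kernel of a homomorphism to a polynomial
ring over `K`, whence primality and transcendence degree counts. -/
theorem aeval_genComb_eq_zero_iff {σ ι : Type} [Fintype ι] (v : ι → σ → K)
    (f : MvPolynomial σ ℂ) :
    aeval (genComb v) f = 0 ↔ ∀ a ∈ Submodule.span K (Set.range v), aeval a f = 0 := by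
  constructor
  · intro h a ha
    obtain ⟨s, rfl⟩ := (Submodule.mem_span_range_iff_exists_fun K).1 ha
    rw [← eval_aeval_genComb, h, map_zero]
  · intro h
    have : Infinite K := Infinite.of_injective _ (algebraMap ℂ K).injective
    apply MvPolynomial.funext
    intro s
    rw [eval_aeval_genComb, map_zero]
    exact h _ ((Submodule.mem_span_range_iff_exists_fun K).2 ⟨s, rfl⟩)

/-- A polynomial over `ℂ` that vanishes on a complex subspace vanishes on its `K`-span. -/
theorem aeval_eq_zero_of_mem_span {σ : Type} {f : MvPolynomial σ ℂ} (V : Submodule ℂ (σ → K))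
    (h : ∀ v ∈ V, aeval v f = 0) {a : σ → K} (ha : a ∈ Submodule.span K (V : Set (σ → K))) :
    aeval a f = 0 := by
  obtain ⟨t, ht, ha⟩ := Submodule.mem_span_finite_of_mem_span ha
  let v : t → σ → K := fun i => i
  have hv : Submodule.span K (Set.range v) = Submodule.span K t := by
    simp [v]
  rw [← hv] at ha
  refine (aeval_genComb_eq_zero_iff v f).1 ?_ a ha
  have hinf : (Set.range (algebraMap ℂ K)).Infinite :=
    Set.infinite_range_of_injective (algebraMap ℂ K).injective
  -- Parameters from the infinite subset ℂ of `K` suffice to detect a zero polynomial.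
  refine MvPolynomial.funext_set (fun _ => Set.range (algebraMap ℂ K)) (fun _ => hinf) ?_
  intro s hs
  choose z hz using fun i => hs i (Set.mem_univ i)
  rw [eval_aeval_genComb, map_zero]
  apply h
  refine Submodule.sum_mem _ fun j _ => ?_
  rw [← hz, algebraMap_smul]
  exact V.smul_mem _ (ht j.2)

/-- The ideal of the polynomials over `ℂ` that vanish on a `K`-subspace. -/
def vanishingOn {σ : Type} (N : Submodule K (σ → K)) : Ideal (MvPolynomial σ ℂ) where
  carrier := {f | ∀ a ∈ N, aeval a f = 0}
  add_mem' := by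
    intro f g hf hg a ha
    rw [map_add, hf a ha, hg a ha, add_zero]
  zero_mem' := fun _ _ => map_zero _
  smul_mem' := by
    intro c f hf a ha
    rw [smul_eq_mul, map_mul, hf a ha, mul_zero]

theorem mem_vanishingOn {σ : Type} {N : Submodule K (σ → K)} {f : MvPolynomial σ ℂ} :
    f ∈ vanishingOn N ↔ ∀ a ∈ N, aeval a f = 0 := Iff.rfl

theorem mem_vanishingOn_iff {σ ι : Type} [Fintype ι] {N : Submodule K (σ → K)} (v : ι → σ → K)
    (hv : Submodule.span K (Set.range v) = N) {f : MvPolynomial σ ℂ} :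
    f ∈ vanishingOn N ↔ aeval (genComb v) f = 0 := by
  rw [aeval_genComb_eq_zero_iff, hv, mem_vanishingOn]

theorem isPrime_vanishingOn {σ : Type} [Finite σ] (N : Submodule K (σ → K)) :
    (vanishingOn N).IsPrime := by
  let b := Module.finBasis K N
  let v : Fin _ → σ → K := fun i => b i
  have hv : Submodule.span K (Set.range v) = N := by
    have : Set.range v = N.subtype '' Set.range b := by
      rw [← Set.range_comp]
      rfl
    rw [this, ← Submodule.map_span, b.span_eq, Submodule.map_top, Submodule.range_subtype]
  have h : vanishingOn N = RingHom.ker (aeval (R := ℂ) (genComb v)) := by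
    ext f
    rw [mem_vanishingOn_iff v hv, RingHom.mem_ker]
  rw [h]
  exact RingHom.ker_isPrime _

/-- A principal ideal that is stable under taking homogeneous components has a homogeneous
generator. -/
theorem exists_homogeneous_generator {σ : Type} {P : Ideal (MvPolynomial σ ℂ)}
    (hP : ∀ f ∈ P, ∀ d, homogeneousComponent d f ∈ P) {f : MvPolynomial σ ℂ}
    (hPf : P = Ideal.span {f}) : f.IsHomogeneous f.totalDegree := by
  have hfP : f ∈ P := hPf ▸ Ideal.mem_span_singleton_self f
  have h : ∀ d, d ≠ f.totalDegree → homogeneousComponent d f = 0 := by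
    intro d hd
    rcases lt_or_gt_of_ne hd with hd | hd
    · by_contra h0
      have h1 := hP f hfP d
      rw [hPf, Ideal.mem_span_singleton] at h1
      have h2 := totalDegree_le_of_dvd_of_isDomain h1 h0
      have h3 := (homogeneousComponent_isHomogeneous d f).totalDegree_le
      omega
    · exact homogeneousComponent_eq_zero _ _ hd
  have h1 := sum_homogeneousComponent f
  rw [Finset.sum_eq_single f.totalDegree (fun d _ hd => h d hd) (by simp)] at h1
  rw [← h1]
  conv => arg 2; rw [h1]
  exact homogeneousComponent_isHomogeneous _ _

end

section

/-! ### Linear substitutions -/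

variable {K : Type} [Field K] [Algebra ℂ K]

/-- Substitution of the linear forms given by the rows of a matrix. -/
noncomputable def pullback {m n : ℕ} (M : Matrix (Fin m) (Fin n) ℂ) :
    MvPolynomial (Fin m) ℂ →ₐ[ℂ] MvPolynomial (Fin n) ℂ :=
  aeval fun i => ∑ j, C (M i j) * X j

theorem aeval_pullback {m n : ℕ} (M : Matrix (Fin m) (Fin n) ℂ) (h : MvPolynomial (Fin m) ℂ)
    (a : Fin n → K) :
    aeval a (pullback M h) = aeval ((M.map (algebraMap ℂ K)).mulVec a) h := by
  have : (aeval (R := ℂ) a).comp (pullback M) = aeval ((M.map (algebraMap ℂ K)).mulVec a) := by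
    ext i
    simp [pullback, Matrix.mulVec, dotProduct]
  rw [← this]
  rfl

theorem eval_pullback {m n : ℕ} (M : Matrix (Fin m) (Fin n) ℂ) (h : MvPolynomial (Fin m) ℂ)
    (a : Fin n → ℂ) : eval a (pullback M h) = eval (M.mulVec a) h :=
  aeval_pullback (K := ℂ) M h a

theorem isHomogeneous_pullback {m n : ℕ} (M : Matrix (Fin m) (Fin n) ℂ)
    {h : MvPolynomial (Fin m) ℂ} {d : ℕ} (hh : h.IsHomogeneous d) :
    (pullback M h).IsHomogeneous d := by
  have h1 := hh.aeval (fun i => ∑ j, C (M i j) * X j : Fin m → MvPolynomial (Fin n) ℂ) (n := 1)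
    fun i => IsHomogeneous.sum _ _ _ fun j _ => isHomogeneous_C_mul_X _ _
  rwa [one_mul] at h1

theorem pderiv_pullback {m n : ℕ} (M : Matrix (Fin m) (Fin n) ℂ) (h : MvPolynomial (Fin m) ℂ)
    (j : Fin n) :
    pderiv j (pullback M h) = ∑ i, C (M i j) * pullback M (pderiv i h) := by
  induction h using MvPolynomial.induction_on with
  | C a => simp [pullback, MvPolynomial.algebraMap_eq]
  | add p q hp hq => simp only [map_add, hp, hq, mul_add, Finset.sum_add_distrib]
  | mul_X p k hp =>
    have h1 : pderiv j (pullback M (X k)) = C (M k j) := by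
      simp [pullback, pderiv_X, Pi.single_apply]
    rw [map_mul, Derivation.leibniz, hp, h1]
    simp only [Derivation.leibniz, map_add, smul_eq_mul, map_mul, pderiv_X, Pi.single_apply, mul_add,
      Finset.sum_add_distrib]
    congr 1
    · simp [mul_comm]
    · rw [Finset.mul_sum]
      exact Finset.sum_congr rfl fun i _ => by ring

theorem grad_pullback {m n : ℕ} (M : Matrix (Fin (m + 1)) (Fin (n + 1)) ℂ)
    (h : MvPolynomial (Fin (m + 1)) ℂ) (ξ : Fin (n + 1) → K) :
    grad ξ (pullback M h) = (M.map (algebraMap ℂ K)).transpose.mulVec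
      (grad ((M.map (algebraMap ℂ K)).mulVec ξ) h) := by
  ext j
  simp [grad, pderiv_pullback, aeval_pullback, Matrix.mulVec, dotProduct]

/-! ### Subsets of projective space and their ideals -/

theorem mk_eq_rep_smul {n : ℕ} {v : Fin (n + 1) → ℂ} (hv : v ≠ 0) :
    ∃ c : ℂ, c ≠ 0 ∧ (Projectivization.mk ℂ v hv).rep = c • v := by
  obtain ⟨a, ha⟩ := Projectivization.exists_smul_eq_mk_rep ℂ v hv
  exact ⟨a, a.ne_zero, ha.symm⟩

theorem smul_mem_cone {n : ℕ} {S : Set (PSpace n)} {v : Fin (n + 1) → ℂ} (hv : v ∈ cone S) {c : ℂ}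
    (hc : c ≠ 0) : c • v ∈ cone S := by
  obtain ⟨h0, h⟩ := hv
  refine ⟨smul_ne_zero hc h0, ?_⟩
  convert h using 1
  rw [Projectivization.mk_eq_mk_iff']
  exact ⟨c, rfl⟩

theorem rep_mem_cone {n : ℕ} {S : Set (PSpace n)} {p : PSpace n} : p.rep ∈ cone S ↔ p ∈ S :=
  ⟨fun ⟨_, h⟩ => by rwa [Projectivization.mk_rep] at h,
    fun h => ⟨p.rep_nonzero, by rwa [Projectivization.mk_rep]⟩⟩

theorem homogeneousComponent_mem_idealOf {n : ℕ} {S : Set (PSpace n)}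
    {f : MvPolynomial (Fin (n + 1)) ℂ} (hf : f ∈ idealOf S) (d : ℕ) :
    homogeneousComponent d f ∈ idealOf S := fun _ hv =>
  aeval_homogeneousComponent_eq_zero (K := ℂ) (fun _ ht => hf _ (smul_mem_cone hv ht)) d

/-- A vector at which all elements of the ideal vanish. -/
theorem mk_mem_zariskiClosure {n : ℕ} {S : Set (PSpace n)} {v : Fin (n + 1) → ℂ} (hv : v ≠ 0) :
    Projectivization.mk ℂ v hv ∈ zariskiClosure S ↔ ∀ f ∈ idealOf S, eval v f = 0 := by
  obtain ⟨c, hc, h⟩ := mk_eq_rep_smul hv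
  have key : ∀ {u w : Fin (n + 1) → ℂ} {c : ℂ}, u = c • w → (∀ f ∈ idealOf S, eval w f = 0) →
      ∀ f ∈ idealOf S, eval u f = 0 := by
    rintro u w c rfl hw f hf
    have h1 := aeval_smul_eq_sum (K := ℂ) f w c
    simp only [aeval_eq_eval] at h1
    refine h1.trans (Finset.sum_eq_zero fun d _ => ?_)
    exact mul_eq_zero_of_right _ (hw _ (homogeneousComponent_mem_idealOf hf d))
  constructor
  · intro h1
    exact key (c := c⁻¹) (by rw [h, inv_smul_smul₀ hc]) h1
  · exact key h

theorem subset_zariskiClosure {n : ℕ} (S : Set (PSpace n)) : S ⊆ zariskiClosure S :=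
  fun _ hp _ hf => hf _ (rep_mem_cone.2 hp)

theorem idealOf_zariskiClosure {n : ℕ} (S : Set (PSpace n)) :
    idealOf (zariskiClosure S) = idealOf S := by
  apply le_antisymm
  · rintro f hf v ⟨h0, hv⟩
    exact hf v ⟨h0, subset_zariskiClosure S hv⟩
  · rintro f hf v ⟨h0, hv⟩
    exact (mk_mem_zariskiClosure h0).1 hv f hf

theorem mem_cone_iff_of_closed {n : ℕ} {S : Set (PSpace n)} (hS : zariskiClosure S = S)
    {v : Fin (n + 1) → ℂ} (hv : v ≠ 0) : v ∈ cone S ↔ ∀ f ∈ idealOf S, eval v f = 0 := by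
  rw [← mk_mem_zariskiClosure hv, hS]
  exact ⟨fun ⟨_, h⟩ => h, fun h => ⟨hv, h⟩⟩

/-! ### Conormal spaces and the dual variety -/

theorem mem_conormal_complex {n : ℕ} {I : Ideal (MvPolynomial (Fin (n + 1)) ℂ)}
    {v a : Fin (n + 1) → ℂ} : a ∈ conormal I v ↔ ∃ h ∈ I, grad v h = a := by
  constructor
  · intro ha
    induction ha using Submodule.span_induction with
    | mem a ha => exact ha
    | zero => exact ⟨0, I.zero_mem, by ext; simp [grad]⟩
    | add a b _ _ ha hb =>
      obtain ⟨f, hf, rfl⟩ := ha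
      obtain ⟨g, hg, rfl⟩ := hb
      exact ⟨f + g, I.add_mem hf hg, by ext; simp [grad]⟩
    | smul c a _ ha =>
      obtain ⟨f, hf, rfl⟩ := ha
      exact ⟨C c * f, I.mul_mem_left _ hf, by ext; simp [grad]⟩
  · rintro ⟨h, hh, rfl⟩
    exact Submodule.subset_span ⟨h, hh, rfl⟩

theorem tangentSpace_eq_perp {n : ℕ} (X : Set (PSpace n)) (p : PSpace n) :
    tangentSpace X p = perp (conormal (idealOf X) p.rep) := by
  ext w
  rw [conormal, mem_perp_span]
  constructor
  · rintro h _ ⟨f, hf, rfl⟩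
    exact h f hf
  · intro h f hf
    exact h _ ⟨f, hf, rfl⟩

theorem isTangentAt_iff {n : ℕ} {X : Set (PSpace n)} {p a : PSpace n} :
    IsTangentAt X p a ↔ a.rep ∈ conormal (idealOf X) p.rep := by
  rw [← perp_perp (conormal _ _), ← tangentSpace_eq_perp, mem_perp]
  simp only [dotProduct_comm _ a.rep]
  rfl

/-- The elements of the ideal of a projective set, after rescaling of the argument. -/
theorem exists_grad_smul_eq {n : ℕ} {S : Set (PSpace n)} {h : MvPolynomial (Fin (n + 1)) ℂ}
    (hh : h ∈ idealOf S) {c : ℂ} (hc : c ≠ 0) :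
    ∃ h' ∈ idealOf S, ∀ v : Fin (n + 1) → ℂ, grad (c • v) h' = grad v h := by
  refine ⟨C c * pullback (c⁻¹ • 1) h, Ideal.mul_mem_left _ _ fun v hv => ?_, fun v => ?_⟩
  · change eval v _ = 0
    rw [eval_pullback, Matrix.smul_mulVec, Matrix.one_mulVec]
    exact hh _ (smul_mem_cone hv (inv_ne_zero hc))
  · have h1 := grad_pullback (K := ℂ) (c⁻¹ • 1) h (c • v)
    have h2 : ((c⁻¹ • 1 : Matrix (Fin (n + 1)) (Fin (n + 1)) ℂ).map (algebraMap ℂ ℂ)) =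
        c⁻¹ • 1 := by ext; simp
    rw [h2] at h1
    have h3 : grad (c • v) (C c * pullback (c⁻¹ • 1) h) =
        c • grad (c • v) (pullback (c⁻¹ • 1) h) := by
      ext i; simp [grad]
    rw [h3, h1, Matrix.transpose_smul, Matrix.transpose_one, Matrix.smul_mulVec,
      Matrix.smul_mulVec, Matrix.one_mulVec, Matrix.one_mulVec, inv_smul_smul₀ hc,
      smul_inv_smul₀ hc]

theorem conormal_smul {n : ℕ} {S : Set (PSpace n)} {c : ℂ} (hc : c ≠ 0) (v : Fin (n + 1) → ℂ) :
    conormal (idealOf S) (c • v) = conormal (idealOf S) v := by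
  ext a
  rw [mem_conormal_complex, mem_conormal_complex]
  constructor
  · rintro ⟨h, hh, rfl⟩
    obtain ⟨h', hh', H⟩ := exists_grad_smul_eq hh (inv_ne_zero hc)
    exact ⟨h', hh', by rw [← H, inv_smul_smul₀ hc]⟩
  · rintro ⟨h, hh, rfl⟩
    obtain ⟨h', hh', H⟩ := exists_grad_smul_eq hh hc
    exact ⟨h', hh', H v⟩

end

/-! ### Generic points of curves and the ideal of the dual variety -/

section

variable {K : Type} [Field K] [Algebra ℂ K]

/-- The coordinate classes in the fraction field of the coordinate ring. The last clause clears
denominators: up to a scalar, every vector over `K` has polynomial entries, so it can be specialized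
to points of X. -/
theorem exists_isGenericPoint {n : ℕ} {X : Set (PSpace n)} (hX : IsIrreducibleCurve X) :
    ∃ (K : Type) (_ : Field K) (_ : Algebra ℂ K) (ξ : Fin (n + 1) → K),
      IsGenericPoint (idealOf X) ξ ∧ Algebra.trdeg ℂ K = 2 ∧
      ∀ w : Fin (n + 1) → K, ∃ g, g ∉ idealOf X ∧
        ∃ W : Fin (n + 1) → MvPolynomial (Fin (n + 1)) ℂ,
          ∀ i, aeval ξ (W i) = aeval ξ g * w i := by
  have := hX.irreducible
  let R := MvPolynomial (Fin (n + 1)) ℂ ⧸ idealOf X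
  let K := FractionRing R
  let ξ : Fin (n + 1) → K := fun i => algebraMap R K (Ideal.Quotient.mk _ (MvPolynomial.X i))
  have hξ : ∀ f, aeval ξ f = algebraMap R K (Ideal.Quotient.mk _ f) := by
    intro f
    have h : aeval ξ = (IsScalarTower.toAlgHom ℂ R K).comp (Ideal.Quotient.mkₐ ℂ (idealOf X)) := by
      ext i
      simp [ξ]
      rfl
    rw [h]
    rfl
  have hgen : IsGenericPoint (idealOf X) ξ := by
    intro f
    rw [hξ, map_eq_zero_iff _ (IsFractionRing.injective R K), Ideal.Quotient.eq_zero_iff_mem]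
  have hR : Algebra.trdeg ℂ R = 2 := trdeg_eq_of_ringKrullDim_eq ℂ R (d := 2) hX.dim_eq_one
  refine ⟨K, inferInstance, inferInstance, ξ, hgen, ?_, ?_⟩
  · have : Algebra.IsAlgebraic R K := 
      (IsFractionRing.comap_isAlgebraic_iff (A := R) (K := K)).2 inferInstance
    rw [← hR, ← trdeg_add_eq ℂ R (A := K), trdeg_eq_zero (R := R), add_zero]
  · intro w
    obtain ⟨b, hb⟩ := IsLocalization.exist_integer_multiples_of_finite (nonZeroDivisors R) w
    obtain ⟨g, hg⟩ := Ideal.Quotient.mk_surjective (b : R)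
    choose y hy using hb
    choose W hW using fun i => Ideal.Quotient.mk_surjective (y i)
    refine ⟨g, fun hgI => nonZeroDivisors.ne_zero b.2 ?_, W, fun i => ?_⟩
    · rw [← hg]
      exact Ideal.Quotient.eq_zero_iff_mem.2 hgI
    · rw [hξ, hξ, hW, hy, hg, Algebra.smul_def]

theorem finrank_conormal {n : ℕ} {X : Set (PSpace n)} (hX : IsIrreducibleCurve X)
    {ξ : Fin (n + 1) → K} (hξ : IsGenericPoint (idealOf X) ξ) (hK : Algebra.trdeg ℂ K = 2) :
    Module.finrank K (perp (conormal (idealOf X) ξ)) = 2 ∧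
      Module.finrank K (conormal (idealOf X) ξ) + 1 = n := by
  have := hX.irreducible
  have h1 := finrank_perp_conormal hξ (d := 2) hK hX.dim_eq_one
  have h2 := finrank_perp (conormal (idealOf X) ξ)
  exact ⟨h1, by omega⟩

theorem le_finrank_of_linearIndependent {K : Type} [Field K] {V : Type*} [AddCommGroup V] [Module K V]
    [FiniteDimensional K V] (N : Submodule K V) {r : ℕ} (v : Fin r → V)
    (hv : LinearIndependent K v) (hN : ∀ i, v i ∈ N) : r ≤ Module.finrank K N := by
  have h : LinearIndependent K (fun i => (⟨v i, hN i⟩ : N)) :=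
    LinearIndependent.of_comp N.subtype hv
  simpa using h.fintype_card_le_finrank

/-- A generic point of a curve specializes to smooth points. -/
theorem exists_notMem_idealOf_forall_finrank {n : ℕ} {X : Set (PSpace n)}
    (hX : IsIrreducibleCurve X) :
    ∃ δ, δ ∉ idealOf X ∧ ∀ v ∈ cone X, eval v δ ≠ 0 →
      Module.finrank ℂ (perp (conormal (idealOf X) v)) = 2 := by
  have hI := hX.irreducible
  obtain ⟨K, _, _, ξ, hξ, hK, hden⟩ := exists_isGenericPoint hX
  obtain ⟨hT, hN⟩ := finrank_conormal hX hξ hK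
  obtain ⟨a, ha, -, hli⟩ := Submodule.exists_fun_fin_finrank_span_eq K (grad ξ '' (idealOf X))
  choose h hhI hh using ha
  obtain ⟨c, hc⟩ := exists_minor_ne_zero a hli
  let b := Module.finBasisOfFinrankEq K _ hT
  choose g hg W hW using fun k => hden (b k : Fin (n + 1) → K)
  have hWli : LinearIndependent K fun k i => aeval ξ (W k i) := by
    have h1 : (fun k i => aeval ξ (W k i)) = fun k =>
        Units.mk0 (aeval ξ (g k)) (fun h0 => hg k ((hξ _).2 h0)) • (b k : Fin (n + 1) → K) := by
      ext k i
      rw [hW]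
      rfl
    rw [h1]
    exact LinearIndependent.units_smul
      (b.linearIndependent.map' (Submodule.subtype _) (Submodule.ker_subtype _)) _
  obtain ⟨e, he⟩ := exists_minor_ne_zero _ hWli
  -- Where `δ₁` is nonzero the conormal space has dimension at least n - 1, and where `δ₂` is
  -- nonzero its complement has dimension at least 2. The two dimensions add up to n + 1, so both
  -- bounds are sharp.
  let δ₁ : MvPolynomial (Fin (n + 1)) ℂ := (Matrix.of fun i j => pderiv (c j) (h i)).det
  let δ₂ : MvPolynomial (Fin (n + 1)) ℂ := (Matrix.of fun i j => W i (e j)).det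
  refine ⟨δ₁ * δ₂, ?_, ?_⟩
  · refine mt hI.mem_or_mem (not_or.2 ⟨?_, ?_⟩)
    · rw [hξ, AlgHom.map_det]
      convert hc using 3
      ext i j
      simp [← hh, grad]
    · rw [hξ, AlgHom.map_det]
      exact he
  · intro v hv hδ
    rw [map_mul] at hδ
    have h1 := left_ne_zero_of_mul hδ
    have h2 := right_ne_zero_of_mul hδ
    rw [RingHom.map_det] at h1 h2
    have h3 : LinearIndependent ℂ fun i => grad v (h i) :=
      linearIndependent_of_minor_ne_zero _ c h1
    have h4 : LinearIndependent ℂ fun (k : Fin 2) i => eval v (W k i) :=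
      linearIndependent_of_minor_ne_zero _ e h2
    have h5 := le_finrank_of_linearIndependent (conormal (idealOf X) v) _ h3 fun i =>
      Submodule.subset_span ⟨h i, hhI i, rfl⟩
    have h6 := le_finrank_of_linearIndependent (perp (conormal (idealOf X) v)) _ h4 fun k => by
      rw [conormal, mem_perp_span]
      rintro _ ⟨f, hf, rfl⟩
      -- Tangency of `W k` holds at `ξ`, hence is membership in the ideal, hence specializes to `v`.
      have h7 : ∑ i, pderiv i f * W k i ∈ idealOf X := by
        rw [hξ, map_sum]
        have h8 := (b k).2 (grad ξ f) (Submodule.subset_span ⟨f, hf, rfl⟩)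
        simp only [map_mul, hW, mul_left_comm _ (aeval ξ (g k)), ← Finset.mul_sum]
        exact mul_eq_zero_of_right _ h8
      have h9 := h7 v hv
      rw [map_sum] at h9
      simp only [map_mul] at h9
      exact h9
    have h10 := finrank_perp (conormal (idealOf X) v)
    have h11 : Module.finrank K (Submodule.span K (grad ξ '' (idealOf X : Set _))) + 1 = n := hN
    omega

/-- Gradient of a polynomial as a vector of polynomials: composition and evaluation. -/
theorem aeval_aeval_pderiv {n : ℕ} (ξ : Fin (n + 1) → K) (f h : MvPolynomial (Fin (n + 1)) ℂ) :
    aeval ξ (aeval (fun i => pderiv i h) f) = aeval (grad ξ h) f := by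
  have : (aeval (R := ℂ) ξ).comp (aeval fun i => pderiv i h) = aeval (grad ξ h) := by
    ext i
    simp [grad]
  rw [← this]
  rfl

/-- The gradients at `ξ` form a ℂ-subspace, so vanishing on them propagates to their `K`-span. The
right-hand side can be tested at the complex points of X. -/
theorem mem_vanishingOn_conormal_iff {n : ℕ} {I : Ideal (MvPolynomial (Fin (n + 1)) ℂ)}
    {ξ : Fin (n + 1) → K} (hξ : IsGenericPoint I ξ) {f : MvPolynomial (Fin (n + 1)) ℂ} :
    f ∈ vanishingOn (conormal I ξ) ↔ ∀ h ∈ I, aeval (fun i => pderiv i h) f ∈ I := by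
  constructor
  · intro hf h hh
    rw [hξ, aeval_aeval_pderiv]
    exact hf _ (Submodule.subset_span ⟨h, hh, rfl⟩)
  · intro hf a ha
    let V : Submodule ℂ (Fin (n + 1) → K) :=
      { carrier := grad ξ '' I
        add_mem' := by
          rintro _ _ ⟨f, hf, rfl⟩ ⟨g, hg, rfl⟩
          exact ⟨f + g, I.add_mem hf hg, by ext; simp [grad]⟩
        zero_mem' := ⟨0, I.zero_mem, by ext; simp [grad]⟩
        smul_mem' := by
          rintro c _ ⟨f, hf, rfl⟩
          exact ⟨C c * f, I.mul_mem_left _ hf, by ext; simp [grad, Algebra.smul_def]⟩ }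
    refine aeval_eq_zero_of_mem_span V ?_ ha
    rintro _ ⟨h, hh, rfl⟩
    rw [← aeval_aeval_pderiv, ← hξ]
    exact hf h hh

/-- Nonzero conormal vectors at points with `δ` nonzero are tangent hyperplanes at smooth points, so
f composed with a gradient vanishes there; primality of the ideal of X removes the factor `δ`.
Conversely, every tangent hyperplane at a smooth point is the gradient of an equation. -/
theorem idealOf_dualVariety {n : ℕ} {X : Set (PSpace n)} (hX : IsIrreducibleCurve X)
    (hn : 2 ≤ n) {ξ : Fin (n + 1) → K} (hξ : IsGenericPoint (idealOf X) ξ) :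
    idealOf (dualVariety X) = vanishingOn (conormal (idealOf X) ξ) := by
  have hI := hX.irreducible
  rw [dualVariety, idealOf_zariskiClosure]
  ext f
  rw [mem_vanishingOn_conormal_iff hξ]
  constructor
  · intro hf h hh
    obtain ⟨δ, hδ, hδX⟩ := exists_notMem_idealOf_forall_finrank hX
    have key : ∀ v ∈ cone X, eval v δ ≠ 0 → ∀ a ∈ conormal (idealOf X) v, a ≠ 0 →
        eval a f = 0 := by
      rintro v ⟨hv, hvX⟩ hδv a ha ha0
      refine hf a ⟨ha0, Projectivization.mk ℂ v hv, ⟨hvX, ?_⟩, ?_⟩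
      · obtain ⟨c, hc, hcv⟩ := mk_eq_rep_smul hv
        rw [tangentSpace_eq_perp, hcv, conormal_smul hc, hδX v ⟨hv, hvX⟩ hδv, hX.dim_eq_one]
        rfl
      · obtain ⟨c, hc, hcv⟩ := mk_eq_rep_smul hv
        obtain ⟨d, hd, hda⟩ := mk_eq_rep_smul ha0
        rw [isTangentAt_iff, hcv, conormal_smul hc, hda]
        exact Submodule.smul_mem _ _ ha
    refine (hI.mem_or_mem (x := δ) fun v hv => ?_).resolve_left hδ
    rw [map_mul]
    by_cases hδv : eval v δ = 0
    · exact mul_eq_zero_of_left hδv _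
    refine mul_eq_zero_of_right _ ((aeval_aeval_pderiv (K := ℂ) v f h).trans ?_)
    -- A zero gradient gives no hyperplane. The constant term of f still vanishes, since f is zero
    -- on the punctured line through some nonzero conormal vector; one exists as n ≥ 2.
    by_cases h0 : grad v h = 0
    · have h1 := finrank_perp (conormal (idealOf X) v)
      rw [hδX v hv hδv] at h1
      obtain ⟨a, ha, ha0⟩ := Submodule.exists_mem_ne_zero_of_ne_bot
        (p := conormal (idealOf X) v) (by
          intro hbot
          rw [hbot, finrank_bot] at h1
          omega)
      have h2 := aeval_homogeneousComponent_eq_zero (K := ℂ) (a := a) (f := f) (fun t ht =>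
        key v hv hδv _ (Submodule.smul_mem _ t ha) (smul_ne_zero ht ha0)) 0
      rw [homogeneousComponent_zero, aeval_C] at h2
      rw [h0, aeval_zero, constantCoeff_eq]
      exact h2
    · exact key v hv hδv _ (Submodule.subset_span ⟨h, hh, rfl⟩) h0
  · rintro hf v ⟨hv, p, hp, hpv⟩
    rw [isTangentAt_iff] at hpv
    obtain ⟨c, hc, hcv⟩ := mk_eq_rep_smul hv
    rw [hcv, Submodule.smul_mem_iff _ hc, mem_conormal_complex] at hpv
    obtain ⟨h, hh, rfl⟩ := hpv
    have h1 : eval p.rep _ = 0 := hf h hh p.rep (rep_mem_cone.2 hp.1)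
    have h2 := aeval_aeval_pderiv (K := ℂ) p.rep f h
    rw [aeval_eq_eval, aeval_eq_eval] at h2
    change eval _ f = 0
    rw [← h1]
    exact h2.symm

end

section

variable {K : Type} [Field K] [Algebra ℂ K]

/-! ### The dual variety is a hypersurface -/

theorem exists_X_notMem_idealOf {n : ℕ} {X : Set (PSpace n)} (hX : (idealOf X).IsPrime) :
    ∃ i, MvPolynomial.X i ∉ idealOf X := by
  by_contra! h
  refine hX.ne_top ((Ideal.eq_top_iff_one _).2 ?_)
  rintro v ⟨hv, hvX⟩
  refine absurd (funext fun i => ?_) hv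
  have := h i v ⟨hv, hvX⟩
  rwa [aeval_X] at this

theorem exists_span_eq {K : Type} [Field K] {σ : Type} [Finite σ] (N : Submodule K (σ → K)) :
    ∃ v : Fin (Module.finrank K N) → σ → K, LinearIndependent K v ∧
      Submodule.span K (Set.range v) = N := by
  let b := Module.finBasis K N
  refine ⟨fun i => b i,
    b.linearIndependent.map' (Submodule.subtype _) (Submodule.ker_subtype _), ?_⟩
  have : Set.range (fun i => (b i : σ → K)) = N.subtype '' Set.range b := by
    rw [← Set.range_comp]
    rfl
  rw [this, ← Submodule.map_span, b.span_eq, Submodule.map_top, Submodule.range_subtype]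

/-- Otherwise ℂ[x₀, …, xₙ] embeds in a polynomial ring over `K` in n - 1 variables. Both have
transcendence degree n + 1, so a nonzero coordinate of `ξ` is algebraic over the smaller ring.
Rescaling a point of X while keeping the gradient separates the powers of this coordinate, so every
coefficient of the relation vanishes on the conormal space. -/
theorem vanishingOn_conormal_ne_bot {n : ℕ} {X : Set (PSpace n)} (hX : IsIrreducibleCurve X)
    {ξ : Fin (n + 1) → K} (hξ : IsGenericPoint (idealOf X) ξ) (hK : Algebra.trdeg ℂ K = 2) :
    vanishingOn (conormal (idealOf X) ξ) ≠ ⊥ := by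
  intro hbot
  have hI := hX.irreducible
  obtain ⟨i₀, hi₀⟩ := exists_X_notMem_idealOf hI
  have hN := (finrank_conormal hX hξ hK).2
  obtain ⟨v, -, hv⟩ := exists_span_eq (conormal (idealOf X) ξ)
  let r := Module.finrank K (conormal (idealOf X) ξ)
  let A := MvPolynomial (Fin (n + 1)) ℂ
  let B := MvPolynomial (Fin r) K
  let φ : A →ₐ[ℂ] B := aeval (genComb v)
  let : Algebra A B := φ.toRingHom.toAlgebra
  have : IsScalarTower ℂ A B := .of_algebraMap_eq fun x => (φ.commutes x).symm
  have hφ : Function.Injective φ := by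
    rw [injective_iff_map_eq_zero]
    intro f hf
    rwa [← Ideal.mem_bot, ← hbot, mem_vanishingOn_iff v hv]
  have : FaithfulSMul A B := (faithfulSMul_iff_algebraMap_injective _ _).2 hφ
  have hB : Algebra.trdeg ℂ B = (n + 1 : ℕ) := by
    rw [← trdeg_add_eq ℂ K (A := B), hK, MvPolynomial.trdeg_of_isDomain, Cardinal.mk_fin,
      Cardinal.lift_natCast, ← hN]
    push_cast
    ring
  have hA : Algebra.trdeg ℂ A = (n + 1 : ℕ) := by
    rw [MvPolynomial.trdeg_of_isDomain, Cardinal.mk_fin, Cardinal.lift_natCast]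
  have : Algebra.IsAlgebraic A B := by
    rw [← trdeg_eq_zero_iff]
    have h := trdeg_add_eq ℂ A (A := B)
    rw [hA, hB] at h
    exact Cardinal.eq_of_add_eq_add_left (h.trans (add_zero _).symm) Cardinal.natCast_lt_aleph0
  obtain ⟨p, hp0, hp⟩ := this.isAlgebraic (C (ξ i₀))
  have h1 : ∀ a ∈ conormal (idealOf X) ξ,
      ∑ k ∈ p.support, aeval a (p.coeff k) * ξ i₀ ^ k = 0 := by
    intro a ha
    rw [← hv] at ha
    obtain ⟨s, rfl⟩ := (Submodule.mem_span_range_iff_exists_fun K).1 ha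
    have h2 := congrArg (eval s) hp
    rw [Polynomial.aeval_def, Polynomial.eval₂_eq_sum, Polynomial.sum, map_sum, map_zero] at h2
    rw [← h2]
    refine Finset.sum_congr rfl fun k _ => ?_
    rw [map_mul, map_pow, eval_C, ← eval_aeval_genComb]
    rfl
  have h2 : ∀ h ∈ idealOf X, ∑ k ∈ p.support,
      aeval (fun i => pderiv i h) (p.coeff k) * MvPolynomial.X i₀ ^ k ∈ idealOf X := by
    intro h hh
    rw [hξ, map_sum, ← h1 (grad ξ h) (Submodule.subset_span ⟨h, hh, rfl⟩)]
    refine Finset.sum_congr rfl fun k _ => ?_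
    rw [map_mul, map_pow, aeval_X, aeval_aeval_pderiv]
  have h3 : ∀ k, p.coeff k ∈ vanishingOn (conormal (idealOf X) ξ) := by
    intro k
    rw [mem_vanishingOn_conormal_iff hξ]
    intro h hh
    refine (hI.mem_or_mem (x := MvPolynomial.X i₀ ^ k) fun v hv => ?_).resolve_left
      (mt (hI.mem_of_pow_mem k) hi₀)
    -- The relation at `c • v`, read as a polynomial in `c` with the gradient at `v` held fixed.
    let q : Polynomial ℂ := ∑ k ∈ p.support,
      Polynomial.C (eval (grad v h) (p.coeff k) * v i₀ ^ k) * Polynomial.X ^ k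
    have hq : q = 0 := polynomial_eq_zero_of_eval q fun c hc => by
      obtain ⟨h', hh', hgrad⟩ := exists_grad_smul_eq hh hc
      have h4 : eval (c • v) _ = 0 := h2 h' hh' _ (smul_mem_cone hv hc)
      rw [map_sum] at h4
      rw [Polynomial.eval_finsetSum, ← h4]
      refine Finset.sum_congr rfl fun k _ => ?_
      have h5 := aeval_aeval_pderiv (K := ℂ) (c • v) (p.coeff k) h'
      rw [hgrad, aeval_eq_eval, aeval_eq_eval] at h5
      rw [map_mul (eval (c • v)), map_pow (eval (c • v)), eval_X, h5]
      simp only [Algebra.algebraMap_self, RingHom.id_apply, Polynomial.eval_mul, Polynomial.eval_C,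
        Polynomial.eval_pow, Polynomial.eval_X, Pi.smul_apply, smul_eq_mul]
      ring
    have h5 := congrArg (Polynomial.coeff · k) hq
    simp only [q, Polynomial.finsetSum_coeff, Polynomial.coeff_C_mul, Polynomial.coeff_X_pow,
      mul_ite, mul_one, mul_zero, Finset.sum_ite_eq, Polynomial.coeff_zero] at h5
    have h6 := aeval_aeval_pderiv (K := ℂ) v (p.coeff k) h
    rw [aeval_eq_eval, aeval_eq_eval] at h6
    change eval v _ = 0
    rw [map_mul, map_pow, eval_X, h6]
    split_ifs at h5 with hk
    · rw [mul_comm]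
      exact h5
    · rw [Polynomial.notMem_support_iff.1 hk]
      simp
  refine hp0 (Polynomial.ext fun k => ?_)
  have := h3 k
  rwa [hbot] at this

/-- Any basis, multiplied by the inverse of a nonsingular maximal minor. -/
theorem exists_reduced_basis {K : Type} [Field K] {σ : Type} [Finite σ] (N : Submodule K (σ → K)) :
    ∃ (ι : Fin (Module.finrank K N) → σ) (e : Fin (Module.finrank K N) → σ → K),
      (∀ k l, e k (ι l) = if k = l then 1 else 0) ∧ Submodule.span K (Set.range e) = N := by
  obtain ⟨v, hv, hvN⟩ := exists_span_eq N
  obtain ⟨ι, hι⟩ := exists_minor_ne_zero v hv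
  let B := Matrix.of fun i j => v i (ι j)
  let e : Fin (Module.finrank K N) → σ → K := fun k => ∑ i, B⁻¹ k i • v i
  have he : ∀ k l, e k (ι l) = if k = l then 1 else 0 := by
    intro k l
    rw [← Matrix.one_apply, ← Matrix.nonsing_inv_mul B (isUnit_iff_ne_zero.2 hι)]
    simp [e, Matrix.mul_apply, B]
  refine ⟨ι, e, he, ?_⟩
  have hli : LinearIndependent K e := by
    apply linearIndependent_of_minor_ne_zero e ι
    have : (Matrix.of fun i j => e i (ι j)) = 1 := by
      ext i j
      rw [Matrix.of_apply, he, Matrix.one_apply]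
    rw [this, Matrix.det_one]
    exact one_ne_zero
  apply Submodule.eq_of_le_of_finrank_eq
  · rw [Submodule.span_le]
    rintro _ ⟨k, rfl⟩
    refine Submodule.sum_mem _ fun i _ => Submodule.smul_mem _ _ ?_
    rw [← hvN]
    exact Submodule.subset_span ⟨i, rfl⟩
  · rw [finrank_span_eq_card hli, Fintype.card_fin]

theorem mem_range_of_isAlgebraic {x : K} (hx : IsAlgebraic ℂ x) : x ∈ (algebraMap ℂ K).range :=
  minpoly.mem_range_of_degree_eq_one ℂ x
    (IsAlgClosed.degree_eq_one_of_irreducible ℂ (minpoly.irreducible hx.isIntegral))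

theorem ringKrullDim_quotient_add_two_le {n : ℕ} {P : Ideal (MvPolynomial (Fin n) ℂ)}
    {f : MvPolynomial (Fin n) ℂ} (hf : Prime f) (hfP : f ∈ P) (hP : P ≠ Ideal.span {f}) :
    ringKrullDim (MvPolynomial (Fin n) ℂ ⧸ P) + 1 + 1 ≤ n := by
  have hle : Ideal.span {f} ≤ P := (Ideal.span_singleton_le_iff_mem _).2 hfP
  obtain ⟨g, hgP, hg⟩ := SetLike.exists_of_lt (lt_of_le_of_ne hle hP.symm)
  have : (Ideal.span {f}).IsPrime := (Ideal.span_singleton_prime hf.ne_zero).2 hf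
  have h1 := ringKrullDim_succ_le_of_surjective (Ideal.Quotient.mk (Ideal.span {f}))
    Ideal.Quotient.mk_surjective (mem_nonZeroDivisors_of_ne_zero hf.ne_zero)
    (Ideal.Quotient.eq_zero_iff_mem.2 (Ideal.mem_span_singleton_self f))
  have h2 := ringKrullDim_succ_le_of_surjective (Ideal.Quotient.factor hle)
    (Ideal.Quotient.factor_surjective hle) (r := Ideal.Quotient.mk _ g)
    (mem_nonZeroDivisors_of_ne_zero (mt Ideal.Quotient.eq_zero_iff_mem.1 hg))
    (Ideal.Quotient.eq_zero_iff_mem.2 hgP)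
  rw [MvPolynomial.ringKrullDim_of_isNoetherianRing, ringKrullDim_eq_zero_of_field, Nat.card_fin,
    zero_add] at h1
  exact (add_le_add_left h2 1).trans h1

/-- If a prime element f of the ideal does not generate it, the quotient has dimension at most r,
the dimension of N. The r pivot coordinates are algebraically independent in it, so every other
coordinate is algebraic over them. With complex values for the pivots, the remaining coordinate of
the vector in N becomes algebraic over ℂ, hence complex, so the reduced basis cannot have an entry
outside ℂ. -/
theorem exists_generator_or_exists_complex_basis {n : ℕ} {N : Submodule K (Fin (n + 1) → K)}
    (hN : Module.finrank K N + 1 = n) (hbot : vanishingOn N ≠ ⊥) :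
    (∃ f, f ≠ 0 ∧ vanishingOn N = Ideal.span {f}) ∨
    ∃ v : Fin (Module.finrank K N) → Fin (n + 1) → ℂ, LinearIndependent ℂ v ∧
      ∀ k, (fun i => algebraMap ℂ K (v k i)) ∈ N := by
  obtain ⟨ι, e, he, hspan⟩ := exists_reduced_basis N
  have heN : ∀ k, e k ∈ N := fun k => hspan ▸ Submodule.subset_span ⟨k, rfl⟩
  by_cases hC : ∀ k j, ∃ c : ℂ, algebraMap ℂ K c = e k j
  · right
    choose v hv using hC
    refine ⟨v, ?_, fun k => ?_⟩
    · apply linearIndependent_of_minor_ne_zero v ι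
      have : (Matrix.of fun i j => v i (ι j)) = 1 := by
        ext i j
        apply (algebraMap ℂ K).injective
        rw [Matrix.of_apply, hv, he, Matrix.one_apply]
        split_ifs <;> simp
      rw [this, Matrix.det_one]
      exact one_ne_zero
    · simp only [hv]
      exact heN k
  left
  push Not at hC
  obtain ⟨k₀, j, hkj⟩ := hC
  have hP := isPrime_vanishingOn N
  obtain ⟨f, hfP, hf⟩ := hP.exists_mem_prime_of_ne_bot hbot
  refine ⟨f, hf.ne_zero, ?_⟩
  by_contra hne
  have hdim := ringKrullDim_quotient_add_two_le hf hfP hne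
  let r := Module.finrank K N
  let S := MvPolynomial (Fin (n + 1)) ℂ ⧸ vanishingOn N
  let A := MvPolynomial (Fin r) ℂ
  let B := MvPolynomial (Fin r) K
  let ψ : A →ₐ[ℂ] S := aeval fun l => Ideal.Quotient.mk _ (X (ι l))
  let θ : S →ₐ[ℂ] B := Ideal.Quotient.liftₐ (vanishingOn N) (aeval (genComb e)) fun g hg =>
    (mem_vanishingOn_iff e hspan).1 hg
  have hθ : ∀ g, θ (Ideal.Quotient.mk _ g) = aeval (genComb e) g := fun g => rfl
  have hθψ : ∀ g, θ (ψ g) = map (algebraMap ℂ K) g := by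
    intro g
    have : θ.comp ψ = mapAlgHom (Algebra.ofId ℂ K) := by
      apply MvPolynomial.algHom_ext
      intro l
      simp only [AlgHom.comp_apply, ψ, aeval_X, hθ, genComb, he]
      simp only [apply_ite C, C_1, C_0, ite_mul, one_mul, zero_mul, Finset.sum_ite_eq',
        Finset.mem_univ, if_true]
      exact (map_X (algebraMap ℂ K) l).symm
    exact congrArg (fun F => F g) this
  have hψ : Function.Injective ψ := by
    have h1 : Function.Injective (θ ∘ ψ) := by
      have h2 : (θ ∘ ψ) = map (algebraMap ℂ K) := funext hθψ
      rw [h2]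
      exact map_injective _ (algebraMap ℂ K).injective
    exact h1.of_comp
  let : Algebra A S := ψ.toRingHom.toAlgebra
  have : IsScalarTower ℂ A S := .of_algebraMap_eq fun x => (ψ.commutes x).symm
  have : FaithfulSMul A S := (faithfulSMul_iff_algebraMap_injective _ _).2 hψ
  have : Algebra.IsAlgebraic A S := by
    obtain ⟨s, hs1, hs2⟩ := exists_ringKrullDim_eq_and_trdeg_eq ℂ S
    have hA : Algebra.trdeg ℂ A = r := by
      rw [MvPolynomial.trdeg_of_isDomain, Cardinal.mk_fin, Cardinal.lift_natCast]
    have hsr : s ≤ r := by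
      change ringKrullDim S + 1 + 1 ≤ _ at hdim
      rw [hs1] at hdim
      have : s + 1 + 1 ≤ n + 1 := by exact_mod_cast hdim
      change r + 1 = n at hN
      omega
    rw [← trdeg_eq_zero_iff]
    have h := trdeg_add_eq ℂ A (A := S)
    rw [hA, hs2] at h
    refine Cardinal.eq_of_add_eq_add_left (h.trans ?_) (Cardinal.natCast_lt_aleph0 (n := r))
    rw [add_zero]
    refine le_antisymm (by exact_mod_cast hsr) ?_
    rw [← h]
    exact le_self_add
  obtain ⟨p, hp0, hp⟩ := this.isAlgebraic (Ideal.Quotient.mk _ (X j) : S)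
  obtain ⟨d, hd⟩ : ∃ d, p.coeff d ≠ 0 := by
    by_contra! h
    exact hp0 (Polynomial.ext h)
  let L : (Fin r → ℂ) →ₗ[ℂ] K :=
    { toFun := fun z => ∑ k, algebraMap ℂ K (z k) * e k j
      map_add' := fun y z => by simp [add_mul, Finset.sum_add_distrib]
      map_smul' := fun c z => by simp [Finset.mul_sum, mul_assoc, Algebra.smul_def] }
  have key : ∀ z : Fin r → ℂ, eval z (p.coeff d) ≠ 0 → L z ∈ (algebraMap ℂ K).range := by
    intro z hz
    apply mem_range_of_isAlgebraic
    refine ⟨p.map (eval z), fun h0 => hz ?_, ?_⟩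
    · rw [← Polynomial.coeff_map, h0, Polynomial.coeff_zero]
    · have h1 := congrArg (fun y => eval (fun k => algebraMap ℂ K (z k)) (θ y)) hp
      simp only [map_zero] at h1
      rw [Polynomial.aeval_def, Polynomial.eval₂_eq_sum, Polynomial.sum, map_sum, map_sum] at h1
      rw [Polynomial.aeval_def, Polynomial.eval₂_map, Polynomial.eval₂_eq_sum, Polynomial.sum, ← h1]
      refine Finset.sum_congr rfl fun k _ => ?_
      rw [map_mul, map_pow, map_mul, map_pow, hθ, aeval_X]
      congr 1
      · change _ = eval _ (θ (ψ _))
        rw [hθψ, eval_map, RingHom.comp_apply]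
        exact hom_eval₂ _ _ _ _
      · congr 1
        simp [genComb, L, mul_comm]
        rfl
  -- By `key` this subspace contains the complement of a hypersurface, while the entry at `k₀`, `j`
  -- makes it proper; a linear form vanishing on it gives the contradiction.
  let W : Submodule ℂ (Fin r → ℂ) := (LinearMap.range (Algebra.linearMap ℂ K)).comap L
  have hW : W < ⊤ := by
    refine lt_top_iff_ne_top.2 fun h => ?_
    have h1 : Pi.single k₀ 1 ∈ W := h ▸ Submodule.mem_top
    obtain ⟨c, hc⟩ := h1
    apply hkj c
    rw [← Algebra.linearMap_apply, hc]
    simp [L, Pi.single_apply, apply_ite (algebraMap ℂ K)]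
  obtain ⟨φ, hφ, hφW⟩ := Submodule.exists_le_ker_of_lt_top W hW
  let l : MvPolynomial (Fin r) ℂ := ∑ k, C (φ fun j => if k = j then 1 else 0) * X k
  have hl : ∀ z, eval z l = φ z := by
    intro z
    rw [LinearMap.pi_apply_eq_sum_univ]
    simp [l, mul_comm]
  have hzero : p.coeff d * l = 0 := by
    apply MvPolynomial.funext
    intro z
    rw [map_mul, map_zero, hl]
    by_cases hz : eval z (p.coeff d) = 0
    · exact mul_eq_zero_of_left hz _
    · obtain ⟨c, hc⟩ := key z hz
      exact mul_eq_zero_of_right _ (hφW ⟨c, hc⟩)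
  refine hφ (LinearMap.ext fun z => ?_)
  rw [← hl, (mul_eq_zero.1 hzero).resolve_left hd, map_zero, LinearMap.zero_apply]

end

section

variable {K : Type} [Field K] [Algebra ℂ K]

/-! ### Linear forms in the ideal of a curve -/

/-- Euler's identity, applied to each homogeneous component. -/
theorem conormal_dotProduct_eq_zero {n : ℕ} {X : Set (PSpace n)} {ξ : Fin (n + 1) → K}
    (hξ : IsGenericPoint (idealOf X) ξ) {a : Fin (n + 1) → K}
    (ha : a ∈ conormal (idealOf X) ξ) : a ⬝ᵥ ξ = 0 := by
  have h1 : ξ ∈ perp (conormal (idealOf X) ξ) := by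
    rw [conormal, mem_perp_span]
    rintro _ ⟨f, hf, rfl⟩
    have h2 : ∑ i, MvPolynomial.X i * pderiv i f ∈ idealOf X := by
      rw [← sum_homogeneousComponent f]
      simp only [map_sum, Finset.mul_sum]
      rw [Finset.sum_comm]
      refine Ideal.sum_mem _ fun d _ => ?_
      rw [(homogeneousComponent_isHomogeneous d f).sum_X_mul_pderiv]
      exact nsmul_mem (homogeneousComponent_mem_idealOf hf d) d
    rw [hξ, map_sum] at h2
    rw [dotProduct_comm, ← h2]
    simp [dotProduct, grad]
  exact h1 a ha

/-- The linear form with the coefficients `v`. -/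
noncomputable def linForm {n : ℕ} (v : Fin (n + 1) → ℂ) : MvPolynomial (Fin (n + 1)) ℂ :=
  ∑ i, C (v i) * X i

theorem eval_linForm {n : ℕ} (v w : Fin (n + 1) → ℂ) : eval w (linForm v) = v ⬝ᵥ w := by
  simp [linForm, dotProduct]

/-- The forms cut out a line containing X. An equation of X not vanishing on that line would make
the coordinate ring a quotient of a polynomial ring in two variables by a nonzero ideal, of
dimension at most 1. -/
theorem isLine_of_linForm_mem {n : ℕ} {X : Set (PSpace n)} (hX : IsIrreducibleCurve X) {r : ℕ}
    (hr : r + 1 = n) (v : Fin r → Fin (n + 1) → ℂ) (hv : LinearIndependent ℂ v)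
    (hvX : ∀ k, linForm (v k) ∈ idealOf X) : IsLine X := by
  let L := perp (Submodule.span ℂ (Set.range v))
  have hL : Module.finrank ℂ L = 2 := by
    have h1 := finrank_perp (Submodule.span ℂ (Set.range v))
    rw [finrank_span_eq_card hv, Fintype.card_fin] at h1
    change r + Module.finrank ℂ L = _ at h1
    omega
  have hXL : ∀ w ∈ cone X, w ∈ L := by
    intro w hw
    rw [mem_perp_span]
    rintro _ ⟨k, rfl⟩
    rw [← eval_linForm]
    exact hvX k w hw
  refine ⟨L, hL, Set.ext fun p => ?_⟩
  rw [Set.mem_ofPred_eq, Projectivization.submodule_eq, Submodule.span_singleton_le_iff_mem]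
  constructor
  · exact fun hp => hXL _ (rep_mem_cone.2 hp)
  intro hp
  obtain ⟨ι, e, he, hspan⟩ := exists_reduced_basis L
  have hLe : ∀ w ∈ L, w = ∑ k, w (ι k) • e k := by
    intro w hw
    rw [← hspan] at hw
    obtain ⟨s, rfl⟩ := (Submodule.mem_span_range_iff_exists_fun ℂ).1 hw
    simp [he]
  let R := MvPolynomial (Fin (n + 1)) ℂ ⧸ idealOf X
  let ρ : MvPolynomial (Fin (Module.finrank ℂ L)) ℂ →ₐ[ℂ] MvPolynomial (Fin (n + 1)) ℂ := rename ι
  let W : MvPolynomial (Fin (n + 1)) ℂ →ₐ[ℂ] MvPolynomial (Fin (Module.finrank ℂ L)) ℂ :=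
    aeval (genComb e)
  have hW : ∀ f w, eval w (ρ (W f)) = eval (∑ k, w (ι k) • e k) f := by
    intro f w
    have h := eval_aeval_genComb (K := ℂ) e f (w ∘ ι)
    rw [eval_rename]
    exact h
  have hρW : ∀ f, Ideal.Quotient.mk (idealOf X) (ρ (W f)) = Ideal.Quotient.mk (idealOf X) f := by
    intro f
    rw [Ideal.Quotient.eq]
    intro w hw
    change eval w _ = 0
    rw [map_sub, hW, ← hLe w (hXL w hw), sub_self]
  have hsurj : Function.Surjective ((Ideal.Quotient.mk (idealOf X)).comp ρ.toRingHom) := by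
    intro x
    obtain ⟨f, rfl⟩ := Ideal.Quotient.mk_surjective x
    exact ⟨W f, hρW f⟩
  have hzero : ∀ f ∈ idealOf X, W f = 0 := by
    intro f hf
    by_contra h0
    have h1 := ringKrullDim_succ_le_of_surjective _ hsurj (mem_nonZeroDivisors_of_ne_zero h0)
      ((hρW f).trans (Ideal.Quotient.eq_zero_iff_mem.2 hf))
    rw [MvPolynomial.ringKrullDim_of_isNoetherianRing, ringKrullDim_eq_zero_of_field, Nat.card_fin,
      zero_add, hL] at h1
    have h2 : ringKrullDim R = 2 := hX.dim_eq_one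
    rw [h2] at h1
    have h3 : (2 : ℕ) + 1 ≤ 2 := by exact_mod_cast h1
    omega
  rw [← hX.closed]
  intro f hf
  rw [hLe _ hp, ← hW, hzero f hf, map_zero, map_zero]

/-! ### Minimal equations -/

/-- A complex basis of the conormal space would, by Euler, be n - 1 independent linear equations of
X, which `hlin` excludes. In this form the result serves both X and its plane projections. -/
theorem exists_generator_idealOf_dualVariety {n : ℕ} {X : Set (PSpace n)}
    (hX : IsIrreducibleCurve X) (hn : 2 ≤ n)
    (hlin : ∀ r, r + 1 = n → ∀ v : Fin r → Fin (n + 1) → ℂ, LinearIndependent ℂ v →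
      ∃ k, linForm (v k) ∉ idealOf X) :
    ∃ f, f ≠ 0 ∧ idealOf (dualVariety X) = Ideal.span {f} := by
  obtain ⟨K, _, _, ξ, hξ, hK, -⟩ := exists_isGenericPoint hX
  have hN := (finrank_conormal hX hξ hK).2
  rw [idealOf_dualVariety hX hn hξ]
  rcases exists_generator_or_exists_complex_basis hN (vanishingOn_conormal_ne_bot hX hξ hK) with
    h | ⟨v, hv, hvN⟩
  · exact h
  · obtain ⟨k, hk⟩ := hlin _ hN v hv
    refine absurd ((hξ _).2 ?_) hk
    rw [← conormal_dotProduct_eq_zero hξ (hvN k)]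
    simp [linForm, dotProduct]

theorem isMinimalEquation_of_idealOf_eq_span {n : ℕ} {S : Set (PSpace n)}
    {f : MvPolynomial (Fin (n + 1)) ℂ} (hS : zariskiClosure S = S) (hf : f ≠ 0)
    (h : idealOf S = Ideal.span {f}) : IsMinimalEquation f S := by
  have hhom : f.IsHomogeneous f.totalDegree :=
    exists_homogeneous_generator (fun _ hg => homogeneousComponent_mem_idealOf hg) h
  refine ⟨⟨hf, hhom, ?_⟩, ?_⟩
  · ext p
    constructor
    · exact fun hp => (h ▸ Ideal.mem_span_singleton_self f : f ∈ idealOf S) _ (rep_mem_cone.2 hp)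
    · intro hp
      rw [← hS]
      intro g hg
      rw [h, Ideal.mem_span_singleton] at hg
      obtain ⟨g, rfl⟩ := hg
      rw [map_mul]
      exact mul_eq_zero_of_left hp _
  · rintro G ⟨hG0, hG, hGS⟩
    have h1 : G ∈ idealOf S := by
      rintro v ⟨hv, hvS⟩
      rw [hGS, Set.mem_ofPred_eq] at hvS
      obtain ⟨c, hc, hcv⟩ := mk_eq_rep_smul hv
      have h2 := aeval_smul_of_isHomogeneous (K := ℂ) hG v c
      rw [hcv, ← aeval_eq_eval, h2] at hvS
      exact (mul_eq_zero.1 hvS).resolve_left (pow_ne_zero _ hc)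
    rw [h, Ideal.mem_span_singleton] at h1
    exact totalDegree_le_of_dvd_of_isDomain h1 hG0

theorem zariskiClosure_dualVariety {n : ℕ} (X : Set (PSpace n)) :
    zariskiClosure (dualVariety X) = dualVariety X := by
  conv_lhs => rw [zariskiClosure, dualVariety, idealOf_zariskiClosure]
  rfl

theorem IsMinimalEquation.totalDegree_eq {n : ℕ} {S : Set (PSpace n)}
    {F G : MvPolynomial (Fin (n + 1)) ℂ} (hF : IsMinimalEquation F S)
    (hG : IsMinimalEquation G S) : F.totalDegree = G.totalDegree :=
  le_antisymm (hF.2 G hG.1) (hG.2 F hF.1)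

/-! ### Restriction to lines -/

/-- Restriction of a homogeneous form of degree `d` to the line `b + T o`. -/
theorem aeval_line_natDegree_le_and_coeff {A σ : Type} [CommRing A] [Algebra ℂ A] (b : σ → A)
    (o : σ → ℂ) {f : MvPolynomial σ ℂ} {d : ℕ} (hf : f.IsHomogeneous d) :
    (aeval (fun i => Polynomial.C (b i) + Polynomial.C (algebraMap ℂ A (o i)) * Polynomial.X)
      f).natDegree ≤ d ∧
    (aeval (fun i => Polynomial.C (b i) + Polynomial.C (algebraMap ℂ A (o i)) * Polynomial.X)
      f).coeff d = algebraMap ℂ A (eval o f) := by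
  let Φ : MvPolynomial σ ℂ →ₐ[ℂ] Polynomial A :=
    aeval fun i => Polynomial.C (b i) + Polynomial.C (algebraMap ℂ A (o i)) * Polynomial.X
  let Q : ℕ → MvPolynomial σ ℂ → Prop := fun d f =>
    (Φ f).natDegree ≤ d ∧ (Φ f).coeff d = algebraMap ℂ A (eval o f)
  have hmul : ∀ d e f g, Q d f → Q e g → Q (d + e) (f * g) := by
    rintro d e f g ⟨hf1, hf2⟩ ⟨hg1, hg2⟩
    refine ⟨?_, ?_⟩
    · rw [map_mul]
      exact Polynomial.natDegree_mul_le_of_le hf1 hg1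
    · rw [map_mul, Polynomial.coeff_mul_add_eq_of_natDegree_le hf1 hg1, hf2, hg2, map_mul, map_mul]
  have hC : ∀ a, Q 0 (C a) := by
    intro a
    have h1 : Φ (C a) = Polynomial.C (algebraMap ℂ A a) := by
      rw [aeval_C]
      rfl
    refine ⟨?_, ?_⟩
    · rw [h1, Polynomial.natDegree_C]
    · rw [h1, Polynomial.coeff_C_zero, eval_C]
  have hX : ∀ i, Q 1 (X i) := by
    intro i
    have h1 : Φ (X i) = Polynomial.C (b i) + Polynomial.C (algebraMap ℂ A (o i)) * Polynomial.X :=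
      aeval_X _ _
    refine ⟨?_, ?_⟩
    · rw [h1]
      compute_degree
    · rw [h1, eval_X]
      simp
  have hXpow : ∀ i k, Q k (X i ^ k) := by
    intro i k
    induction k with
    | zero => simpa using hC 1
    | succ k ih =>
      rw [pow_succ]
      exact hmul _ _ _ _ ih (hX i)
  have hprod : ∀ (m : σ →₀ ℕ) (s : Finset σ), Q (∑ i ∈ s, m i) (∏ i ∈ s, X i ^ m i) := by
    classical
    intro m s
    induction s using Finset.induction_on with
    | empty => simpa using hC 1
    | insert i s his ih =>
      rw [Finset.sum_insert his, Finset.prod_insert his]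
      exact hmul _ _ _ _ (hXpow i _) ih
  change Q d f
  rw [f.as_sum]
  have hsum : ∀ s : Finset (σ →₀ ℕ), s ⊆ f.support → Q d (∑ m ∈ s, monomial m (coeff m f)) := by
    classical
    intro s
    induction s using Finset.induction_on with
    | empty => intro _; simp [Q]
    | insert m s hms ih =>
      intro hs
      rw [Finset.sum_insert hms]
      have h1 : Q d (monomial m (coeff m f)) := by
        have h2 : ∑ i ∈ m.support, m i = d := by
          by_contra h
          exact mem_support_iff.1 (hs (Finset.mem_insert_self m s)) (hf.coeff_eq_zero h)
        rw [monomial_eq, ← h2, ← zero_add (∑ i ∈ m.support, m i)]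
        exact hmul _ _ _ _ (hC _) (hprod m _)
      have h2 := ih fun x hx => hs (Finset.mem_insert_of_mem hx)
      refine ⟨?_, ?_⟩
      · rw [map_add]
        exact Polynomial.natDegree_add_le_of_degree_le h1.1 h2.1
      · rw [map_add, Polynomial.coeff_add, h1.2, h2.2, map_add, map_add]
  exact hsum _ subset_rfl

end

section

variable {K : Type} [Field K] [Algebra ℂ K]

/-! ### Projection from a point outside the curve -/

theorem exists_right_inverse_of_hasCentre {M : Matrix (Fin 3) (Fin 4) ℂ} {O : PSpace 3}
    (hM : HasCentre M O) : ∃ B : Matrix (Fin 4) (Fin 3) ℂ, M * B = 1 := by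
  rw [← Matrix.mulVec_surjective_iff_exists_right_inverse]
  have h := LinearMap.finrank_range_add_finrank_ker M.mulVecLin
  rw [hM, Projectivization.finrank_submodule] at h
  have h1 : LinearMap.range M.mulVecLin = ⊤ := by
    apply Submodule.eq_top_of_finrank_eq
    simp only [Module.finrank_fin_fun] at h ⊢
    omega
  exact LinearMap.range_eq_top.1 h1

theorem mulVec_rep_centre {M : Matrix (Fin 3) (Fin 4) ℂ} {O : PSpace 3} (hM : HasCentre M O) :
    M.mulVec O.rep = 0 := by
  have h : O.rep ∈ LinearMap.ker M.mulVecLin := by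
    rw [hM, Projectivization.submodule_eq]
    exact Submodule.mem_span_singleton_self _
  exact h

theorem exists_eq_smul_of_mulVec_eq_zero {M : Matrix (Fin 3) (Fin 4) ℂ} {O : PSpace 3}
    (hM : HasCentre M O) {v : Fin 4 → ℂ} (hv : M.mulVec v = 0) : ∃ c : ℂ, v = c • O.rep := by
  have h : v ∈ LinearMap.ker M.mulVecLin := hv
  rw [hM, Projectivization.submodule_eq, Submodule.mem_span_singleton] at h
  obtain ⟨c, hc⟩ := h
  exact ⟨c, hc.symm⟩

theorem mulVec_ne_zero_of_mem_cone {X : Set (PSpace 3)} {M : Matrix (Fin 3) (Fin 4) ℂ}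
    {O : PSpace 3} (hM : HasCentre M O) (hO : O ∉ X) {v : Fin 4 → ℂ} (hv : v ∈ cone X) :
    M.mulVec v ≠ 0 := by
  intro h
  obtain ⟨c, rfl⟩ := exists_eq_smul_of_mulVec_eq_zero hM h
  have hc : c ≠ 0 := by
    rintro rfl
    exact hv.1 (zero_smul _ _)
  have h1 := smul_mem_cone hv (inv_ne_zero hc)
  rw [inv_smul_smul₀ hc, rep_mem_cone] at h1
  exact hO h1

theorem mem_cone_projection {X : Set (PSpace 3)} {M : Matrix (Fin 3) (Fin 4) ℂ}
    {O : PSpace 3} (hM : HasCentre M O) (hO : O ∉ X) {w : Fin 3 → ℂ} :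
    w ∈ cone (projection M X) ↔ ∃ v ∈ cone X, M.mulVec v = w := by
  constructor
  · rintro ⟨hw, p, hp, h, hpw⟩
    rw [Projectivization.mk_eq_mk_iff'] at hpw
    obtain ⟨c, hc⟩ := hpw
    have hc0 : c ≠ 0 := by
      rintro rfl
      exact hw (by rw [← hc, zero_smul])
    exact ⟨c • p.rep, smul_mem_cone (rep_mem_cone.2 hp) hc0, by rw [Matrix.mulVec_smul, hc]⟩
  · rintro ⟨v, hv, rfl⟩
    refine ⟨mulVec_ne_zero_of_mem_cone hM hO hv, ?_⟩
    obtain ⟨hv0, hvX⟩ := hv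
    refine ⟨_, hvX, mulVec_ne_zero_of_mem_cone hM hO (rep_mem_cone.2 hvX), ?_⟩
    obtain ⟨c, hc, hcv⟩ := mk_eq_rep_smul hv0
    rw [Projectivization.mk_eq_mk_iff']
    refine ⟨c⁻¹, ?_⟩
    rw [hcv, Matrix.mulVec_smul, inv_smul_smul₀ hc]

theorem mem_idealOf_projection {X : Set (PSpace 3)} {M : Matrix (Fin 3) (Fin 4) ℂ}
    {O : PSpace 3} (hM : HasCentre M O) (hO : O ∉ X) {g : MvPolynomial (Fin 3) ℂ} :
    g ∈ idealOf (projection M X) ↔ pullback M g ∈ idealOf X := by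
  constructor
  · intro hg v hv
    change eval v _ = 0
    rw [eval_pullback]
    exact hg _ ((mem_cone_projection hM hO).2 ⟨v, hv, rfl⟩)
  · intro hg w hw
    obtain ⟨v, hv, rfl⟩ := (mem_cone_projection hM hO).1 hw
    change eval _ g = 0
    rw [← eval_pullback]
    exact hg v hv

/-- The homomorphism of coordinate rings given by a projection. -/
noncomputable def projectionHom (X : Set (PSpace 3)) (M : Matrix (Fin 3) (Fin 4) ℂ) :
    MvPolynomial (Fin 3) ℂ →ₐ[ℂ] MvPolynomial (Fin 4) ℂ ⧸ idealOf X :=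
  (Ideal.Quotient.mkₐ ℂ (idealOf X)).comp (pullback M)

theorem projectionHom_apply (X : Set (PSpace 3)) (M : Matrix (Fin 3) (Fin 4) ℂ)
    (g : MvPolynomial (Fin 3) ℂ) :
    projectionHom X M g = Ideal.Quotient.mk (idealOf X) (pullback M g) := rfl

/-- Some form f in the ideal of X is nonzero at O. Expanded along the direction of O, it has the
nonzero constant f(O) as leading coefficient, which gives a monic equation for the one coordinate
lost by projecting. -/
theorem isIntegral_projectionHom {X : Set (PSpace 3)} (hX : IsIrreducibleCurve X)
    {M : Matrix (Fin 3) (Fin 4) ℂ} {O : PSpace 3} (hM : HasCentre M O) (hO : O ∉ X) :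
    (projectionHom X M).toRingHom.IsIntegral := by
  obtain ⟨B, hB⟩ := exists_right_inverse_of_hasCentre hM
  obtain ⟨d, f, hfX, hfd, hfO⟩ : ∃ d, ∃ f ∈ idealOf X, f.IsHomogeneous d ∧ eval O.rep f ≠ 0 := by
    have h1 : O.rep ∉ cone X := mt rep_mem_cone.1 hO
    rw [mem_cone_iff_of_closed hX.closed O.rep_nonzero] at h1
    push Not at h1
    obtain ⟨f, hf, hfO⟩ := h1
    by_contra! h
    apply hfO
    rw [← sum_homogeneousComponent f, map_sum]
    exact Finset.sum_eq_zero fun d _ => h d _ (homogeneousComponent_mem_idealOf hf d)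
      (homogeneousComponent_isHomogeneous d f)
  obtain ⟨i₀, hi₀⟩ : ∃ i, O.rep i ≠ 0 := by
    by_contra! h
    exact O.rep_nonzero (funext h)
  let R := MvPolynomial (Fin 4) ℂ ⧸ idealOf X
  let A := MvPolynomial (Fin 3) ℂ
  let φ : A →ₐ[ℂ] R := projectionHom X M
  let b : Fin 4 → A := fun i => ∑ j, C (B i j) * MvPolynomial.X j
  -- The coordinate along the centre: every v equals BMv + l(v)O.
  let l : MvPolynomial (Fin 4) ℂ := C (O.rep i₀)⁻¹ * (MvPolynomial.X i₀ - pullback M (b i₀))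
  have hbev : ∀ v i, eval v (pullback M (b i)) = (B.mulVec (M.mulVec v)) i := by
    intro v i
    rw [eval_pullback]
    simp [b, Matrix.mulVec, dotProduct]
  have hXi : ∀ i, (MvPolynomial.X i : MvPolynomial (Fin 4) ℂ) = pullback M (b i) + C (O.rep i) * l := by
    intro i
    apply MvPolynomial.funext
    intro v
    have h1 : M.mulVec (v - B.mulVec (M.mulVec v)) = 0 := by
      rw [Matrix.mulVec_sub, Matrix.mulVec_mulVec, hB, Matrix.one_mulVec, sub_self]
    obtain ⟨c, hc⟩ := exists_eq_smul_of_mulVec_eq_zero hM h1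
    have h2 : ∀ i, v i = (B.mulVec (M.mulVec v)) i + c * O.rep i := by
      intro i
      have := congrFun hc i
      simp only [Pi.sub_apply, Pi.smul_apply, smul_eq_mul] at this
      rw [← this]
      ring
    simp only [l, map_add, map_mul, map_sub, eval_X, eval_C, hbev]
    have h3 := h2 i₀
    have h4 := h2 i
    rw [h4]
    conv_rhs => rw [h3]
    field_simp
    ring
  let ℓ : R := Ideal.Quotient.mk _ l
  let p : Polynomial A :=
    aeval (fun i => Polynomial.C (b i) + Polynomial.C (algebraMap ℂ A (O.rep i)) * Polynomial.X) f
  have hp := aeval_line_natDegree_le_and_coeff b O.rep hfd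
  have hpℓ : p.eval₂ φ.toRingHom ℓ = 0 := by
    have h1 : ∀ g : MvPolynomial (Fin 4) ℂ, (aeval (fun i => Polynomial.C (b i) +
        Polynomial.C (algebraMap ℂ A (O.rep i)) * Polynomial.X) g :
          Polynomial A).eval₂ φ.toRingHom ℓ = Ideal.Quotient.mk _ g := by
      intro g
      induction g using MvPolynomial.induction_on with
      | C a =>
        rw [aeval_C, Polynomial.algebraMap_apply, Polynomial.eval₂_C]
        exact φ.commutes a
      | add g h hg hh => rw [map_add, Polynomial.eval₂_add, hg, hh, map_add]
      | mul_X g i hg =>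
        rw [map_mul, Polynomial.eval₂_mul, hg, map_mul, aeval_X, hXi i, map_add, map_mul]
        simp only [Polynomial.eval₂_add, Polynomial.eval₂_mul, Polynomial.eval₂_C,
          Polynomial.eval₂_X]
        have h1 : φ.toRingHom (algebraMap ℂ A (O.rep i)) =
            Ideal.Quotient.mk (idealOf X) (C (O.rep i)) := φ.commutes _
        rw [h1]
        rfl
    rw [h1]
    exact Ideal.Quotient.eq_zero_iff_mem.2 hfX
  have hℓ : φ.toRingHom.IsIntegralElem ℓ := by
    refine ⟨Polynomial.C (C (eval O.rep f)⁻¹) * p, ?_, ?_⟩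
    · apply Polynomial.monic_of_natDegree_le_of_coeff_eq_one d
      · exact (Polynomial.natDegree_C_mul_le _ _).trans hp.1
      · rw [Polynomial.coeff_C_mul, hp.2, algebraMap_eq, ← C_mul, inv_mul_cancel₀ hfO, C_1]
    · rw [Polynomial.eval₂_mul, hpℓ, mul_zero]
  intro x
  obtain ⟨g, rfl⟩ := Ideal.Quotient.mk_surjective x
  induction g using MvPolynomial.induction_on with
  | C a =>
    have h1 : Ideal.Quotient.mk (idealOf X) (C a) = φ.toRingHom (C a) := (φ.commutes a).symm
    rw [h1]
    exact RingHom.isIntegralElem_map _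
  | add g h hg hh =>
    rw [map_add]
    exact RingHom.IsIntegralElem.add _ hg hh
  | mul_X g i hg =>
    rw [map_mul]
    refine RingHom.IsIntegralElem.mul _ hg ?_
    rw [hXi, map_add, map_mul]
    refine RingHom.IsIntegralElem.add _ (RingHom.isIntegralElem_map (x := b i) _)
      (RingHom.IsIntegralElem.mul _ ?_ hℓ)
    have h1 : Ideal.Quotient.mk (idealOf X) (C (O.rep i)) = φ.toRingHom (C (O.rep i)) :=
      (φ.commutes _).symm
    rw [h1]
    exact RingHom.isIntegralElem_map _

/-- Integrality gives a maximal ideal over the one of any point of the closure, and the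
Nullstellensatz turns it into a point of X: the image is closed. Integrality also preserves the
dimension. -/
theorem isIrreducibleCurve_projection {X : Set (PSpace 3)} (hX : IsIrreducibleCurve X)
    {M : Matrix (Fin 3) (Fin 4) ℂ} {O : PSpace 3} (hM : HasCentre M O) (hO : O ∉ X) :
    IsIrreducibleCurve (projection M X) := by
  have hI := hX.irreducible
  have hcomap : idealOf (projection M X) = (idealOf X).comap (pullback M) := by
    ext g
    exact mem_idealOf_projection hM hO
  have hker : ∀ g, projectionHom X M g = 0 ↔ g ∈ idealOf (projection M X) := by
    intro g
    rw [projectionHom_apply, Ideal.Quotient.eq_zero_iff_mem, mem_idealOf_projection hM hO]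
  have hint := isIntegral_projectionHom hX hM hO
  refine ⟨?_, ?_, ?_⟩
  · refine Set.Subset.antisymm (fun q hq => ?_) (subset_zariskiClosure _)
    let m := vanishingIdeal ℂ {q.rep}
    have hm : m.IsMaximal := isMaximal_iff_eq_vanishingIdeal_singleton.2 ⟨q.rep, rfl⟩
    let : Algebra (MvPolynomial (Fin 3) ℂ) (MvPolynomial (Fin 4) ℂ ⧸ idealOf X) :=
      (projectionHom X M).toRingHom.toAlgebra
    have : Algebra.IsIntegral (MvPolynomial (Fin 3) ℂ) (MvPolynomial (Fin 4) ℂ ⧸ idealOf X) :=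
      ⟨hint⟩
    obtain ⟨Q, hQ, hQm⟩ := Ideal.exists_ideal_over_maximal_of_isIntegral
      (S := MvPolynomial (Fin 4) ℂ ⧸ idealOf X) m (by
        intro g hg w hw
        rw [hw]
        exact hq g ((hker g).1 hg))
    have hQ' : (Q.comap (Ideal.Quotient.mk (idealOf X))).IsMaximal :=
      Ideal.comap_isMaximal_of_surjective _ Ideal.Quotient.mk_surjective
    obtain ⟨v, hv⟩ := isMaximal_iff_eq_vanishingIdeal_singleton.1 hQ'
    have hvX : ∀ f ∈ idealOf X, eval v f = 0 := by
      intro f hf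
      have h1 : f ∈ Q.comap (Ideal.Quotient.mk (idealOf X)) := by
        rw [Ideal.mem_comap, Ideal.Quotient.eq_zero_iff_mem.2 hf]
        exact Q.zero_mem
      rw [hv] at h1
      exact h1 v rfl
    have hMv : M.mulVec v = q.rep := by
      ext i
      have h1 : MvPolynomial.X i - C (q.rep i) ∈ m := by
        rintro w rfl
        simp
      rw [← hQm] at h1
      have h2 : pullback M (MvPolynomial.X i - C (q.rep i)) ∈ Q.comap (Ideal.Quotient.mk (idealOf X)) := h1
      rw [hv] at h2
      have h3 : eval v _ = 0 := h2 v rfl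
      rw [eval_pullback, map_sub, eval_X, eval_C, sub_eq_zero] at h3
      exact h3
    have hv0 : v ≠ 0 := by
      rintro rfl
      rw [Matrix.mulVec_zero] at hMv
      exact q.rep_nonzero hMv.symm
    rw [← rep_mem_cone, mem_cone_projection hM hO]
    exact ⟨v, (mem_cone_iff_of_closed hX.closed hv0).2 hvX, hMv⟩
  · rw [hcomap]
    exact Ideal.comap_isPrime _ _
  · let φ : MvPolynomial (Fin 3) ℂ ⧸ idealOf (projection M X) →+*
        MvPolynomial (Fin 4) ℂ ⧸ idealOf X :=
      Ideal.Quotient.lift _ (projectionHom X M).toRingHom fun g hg => (hker g).2 hg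
    let : Algebra (MvPolynomial (Fin 3) ℂ ⧸ idealOf (projection M X))
        (MvPolynomial (Fin 4) ℂ ⧸ idealOf X) := φ.toAlgebra
    have hφ : Function.Injective φ := by
      rw [injective_iff_map_eq_zero]
      intro x hx
      obtain ⟨g, rfl⟩ := Ideal.Quotient.mk_surjective x
      exact Ideal.Quotient.eq_zero_iff_mem.2 ((hker g).1 hx)
    have hφint : φ.IsIntegral := by
      refine RingHom.IsIntegral.tower_top (Ideal.Quotient.mk _) φ ?_
      exact hint
    have : Algebra.IsIntegral (MvPolynomial (Fin 3) ℂ ⧸ idealOf (projection M X))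
        (MvPolynomial (Fin 4) ℂ ⧸ idealOf X) := ⟨hφint⟩
    exact (ringKrullDim_eq_of_injective_of_isIntegral _ _ hφ).trans hX.dim_eq_one

theorem IsGenericPoint.projection {X : Set (PSpace 3)} {ξ : Fin 4 → K}
    (hξ : IsGenericPoint (idealOf X) ξ) {M : Matrix (Fin 3) (Fin 4) ℂ} {O : PSpace 3}
    (hM : HasCentre M O) (hO : O ∉ X) :
    IsGenericPoint (idealOf (projection M X)) ((M.map (algebraMap ℂ K)).mulVec ξ) := by
  intro g
  rw [mem_idealOf_projection hM hO, hξ, aeval_pullback]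

/-- The conormal space of a projection consists of the planes through the centre that are
conormal to the curve. -/
theorem mem_conormal_projection_iff {X : Set (PSpace 3)} (hX : IsIrreducibleCurve X) {ξ : Fin 4 → K}
    (hξ : IsGenericPoint (idealOf X) ξ) (hK : Algebra.trdeg ℂ K = 2)
    {M : Matrix (Fin 3) (Fin 4) ℂ} {O : PSpace 3} (hM : HasCentre M O) (hO : O ∉ X)
    (hgen : ∃ a ∈ conormal (idealOf X) ξ, a ⬝ᵥ (fun i => algebraMap ℂ K (O.rep i)) ≠ 0)
    {b : Fin 3 → K} :
    b ∈ conormal (idealOf (projection M X)) ((M.map (algebraMap ℂ K)).mulVec ξ) ↔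
      (M.map (algebraMap ℂ K)).transpose.mulVec b ∈ conormal (idealOf X) ξ := by
  let MK := M.map (algebraMap ℂ K)
  let o : Fin 4 → K := fun i => algebraMap ℂ K (O.rep i)
  let N : Submodule K (Fin 4 → K) := conormal (idealOf X) ξ
  let N₁ : Submodule K (Fin 3 → K) := conormal (idealOf (projection M X)) (MK.mulVec ξ)
  let N₂ := N.comap MK.transpose.mulVecLin
  have hN := (finrank_conormal hX hξ hK).2
  have hN₁ := (finrank_conormal (isIrreducibleCurve_projection hX hM hO)
    (hξ.projection hM hO) hK).2
  have hle : N₁ ≤ N₂ := by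
    refine Submodule.span_le.2 ?_
    rintro _ ⟨g, hg, rfl⟩
    change MK.transpose.mulVec (grad _ g) ∈ N
    rw [← grad_pullback]
    exact Submodule.subset_span ⟨_, (mem_idealOf_projection hM hO).1 hg, rfl⟩
  obtain ⟨B, hB⟩ := exists_right_inverse_of_hasCentre hM
  have hinj : Function.Injective MK.transpose.mulVecLin := by
    have h1 : (B.map (algebraMap ℂ K)).transpose * MK.transpose = 1 := by
      rw [← Matrix.transpose_mul, ← Matrix.map_mul, hB]
      simp
    intro x y hxy
    have h2 := congrArg (B.map (algebraMap ℂ K)).transpose.mulVec hxy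
    simpa only [Matrix.mulVecLin_apply, Matrix.mulVec_mulVec, h1, Matrix.one_mulVec] using h2
  have hMo : MK.mulVec o = 0 := by
    ext i
    have h1 := congrArg (algebraMap ℂ K) (congrFun (mulVec_rep_centre hM) i)
    rw [Pi.zero_apply, map_zero] at h1
    rw [Pi.zero_apply, ← h1]
    simp [MK, o, Matrix.mulVec, dotProduct]
  -- Vectors in the image of the transpose are orthogonal to O, so the vector from `hgen` is missed.
  -- Thus `N₂` has dimension at most 1, which `N₁` already attains.
  have hlt : N₂.map MK.transpose.mulVecLin < N := by
    refine lt_of_le_of_ne (Submodule.map_comap_le _ _) fun heq => ?_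
    obtain ⟨a, ha, hao⟩ := hgen
    change a ∈ N at ha
    rw [← heq] at ha
    obtain ⟨b, -, rfl⟩ := ha
    apply hao
    rw [Matrix.mulVecLin_apply, Matrix.mulVec_transpose, ← Matrix.dotProduct_mulVec]
    change b ⬝ᵥ MK.mulVec o = 0
    rw [hMo, dotProduct_zero]
  have h1 := Submodule.finrank_lt_finrank_of_lt hlt
  rw [← (Submodule.equivMapOfInjective _ hinj _).finrank_eq] at h1
  have heq : N₁ = N₂ := by
    apply Submodule.eq_of_le_of_finrank_le hle
    change Module.finrank K N + 1 = 3 at hN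
    change Module.finrank K N₁ + 1 = 2 at hN₁
    omega
  change b ∈ N₁ ↔ b ∈ N₂
  rw [heq]

end

section

variable {K : Type} [Field K] [Algebra ℂ K]

/-! ### Restriction of forms to the hyperplane sections of a plane -/

/-- Applying a linear form to the coefficients of a polynomial. -/
theorem exists_forall_eval_eq {σ : Type} (ψ : K →ₗ[ℂ] ℂ) (E : MvPolynomial σ K) :
    ∃ F : MvPolynomial σ ℂ, ∀ ω : σ → ℂ,
      eval ω F = ψ (eval (fun i => algebraMap ℂ K (ω i)) E) := by
  refine ⟨∑ m ∈ E.support, monomial m (ψ (coeff m E)), fun ω => ?_⟩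
  rw [map_sum, eval_eq (f := E), map_sum]
  refine Finset.sum_congr rfl fun m _ => ?_
  rw [eval_monomial, Finsupp.prod, mul_comm (coeff m E)]
  simp only [← map_pow, ← map_prod]
  rw [← Algebra.smul_def, map_smul, smul_eq_mul, mul_comm]

theorem eval_aeval_polynomial {σ : Type} (p : σ → Polynomial ℂ) (F : MvPolynomial σ ℂ) (t : ℂ) :
    (aeval p F).eval t = eval (fun i => (p i).eval t) F := by
  have h : ((Polynomial.aeval t).comp (aeval p) : MvPolynomial σ ℂ →ₐ[ℂ] ℂ) =
      aeval fun i => (p i).eval t := by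
    ext i
    simp
  exact DFunLike.congr_fun h F

/-- If `Υ` generates the ideal of the plane spanned by `e₂` and `e₃` and is monic in the first
variable, then the forms of smaller degree in the point of intersection with the hyperplane
`z₂ + t z₃ = 0` are linearly independent over the polynomials in `t`. -/
theorem eq_zero_of_forall_pencil {e₂ e₃ : Fin 4 → K} (h22 : e₂ 2 = 1) (h23 : e₂ 3 = 0)
    (h32 : e₃ 2 = 0) (h33 : e₃ 3 = 1) {d : ℕ} {Υ : MvPolynomial (Fin 4) ℂ}
    (hΥ : vanishingOn (Submodule.span K {e₂, e₃}) = Ideal.span {Υ})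
    (hd : Υ.IsHomogeneous (d + 1)) (h0 : eval (Pi.single 0 1) Υ ≠ 0)
    {S : Finset (Fin 3 →₀ ℕ)} (hS : ∀ μ ∈ S, ∑ k, μ k = d) (G : (Fin 3 →₀ ℕ) → Polynomial ℂ)
    (hG : ∀ t : ℂ, ∑ μ ∈ S, algebraMap ℂ K ((G μ).eval t) *
      ∏ k, (algebraMap ℂ K t * e₂ (Fin.succAbove 2 k) - e₃ (Fin.succAbove 2 k)) ^ μ k = 0) :
    ∀ μ ∈ S, G μ = 0 := by
  let s : Fin 3 → Fin 4 := Fin.succAbove 2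
  let D := S.sup fun μ => (G μ).natDegree
  have hD : ∀ μ ∈ S, (G μ).natDegree < D + 1 := fun μ hμ =>
    Nat.lt_succ_of_le (Finset.le_sup (f := fun μ => (G μ).natDegree) hμ)
  let g : (Fin 3 →₀ ℕ) → MvPolynomial (Fin 4) ℂ := fun μ =>
    ∑ k ∈ Finset.range (D + 1), C ((G μ).coeff k) * (-X 2) ^ k * X 3 ^ (D - k)
  -- The relation homogenized under t = -x₂/x₃. The extra factor x₃ takes care of the points where t
  -- is undefined.
  let H : MvPolynomial (Fin 4) ℂ := X 3 * ∑ μ ∈ S, g μ * ∏ k, X (s k) ^ μ k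
  -- the value of `H` in terms of the dehomogenized coefficients
  have hg : ∀ (L : Type) [Field L] [Algebra ℂ L], ∀ μ ∈ S, ∀ (v : Fin 4 → L) (t b : ℂ),
      v 2 = -algebraMap ℂ L (t * b) → v 3 = algebraMap ℂ L b →
      aeval v (g μ) = algebraMap ℂ L (b ^ D) * algebraMap ℂ L ((G μ).eval t) := by
    intro L _ _ μ hμ v t b h2 h3
    rw [Polynomial.eval_eq_sum_range' (hD μ hμ), ← map_mul, Finset.mul_sum, map_sum, map_sum]
    refine Finset.sum_congr rfl fun k hk => ?_
    have hk' : k ≤ D := Nat.lt_succ_iff.1 (Finset.mem_range.1 hk)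
    simp only [map_mul, map_pow, map_neg, aeval_C, aeval_X, h2, h3, neg_neg]
    rw [mul_pow]
    conv_rhs => rw [← Nat.sub_add_cancel hk', pow_add]
    ring
  have hHN : H ∈ vanishingOn (Submodule.span K {e₂, e₃}) := by
    intro v hv
    -- Only complex combinations a e₂ + b e₃ need checking, and for b ≠ 0 these are -b (t e₂ - e₃)
    -- with t = -a/b.
    refine aeval_eq_zero_of_mem_span (Submodule.span ℂ {e₂, e₃}) ?_
      (Submodule.span_mono Submodule.subset_span hv)
    intro v hv
    obtain ⟨a, b, rfl⟩ := Submodule.mem_span_pair.1 hv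
    by_cases hb : b = 0
    · simp [H, hb, h23]
    have h2 : (a • e₂ + b • e₃) 2 = -algebraMap ℂ K (-a / b * b) := by
      rw [div_mul_cancel₀ _ hb]
      simp [h22, h32, Algebra.smul_def]
    have h3 : (a • e₂ + b • e₃) 3 = algebraMap ℂ K b := by
      simp [h23, h33, Algebra.smul_def]
    have hk : ∀ k, (a • e₂ + b • e₃) (s k) =
        -algebraMap ℂ K b * (algebraMap ℂ K (-a / b) * e₂ (s k) - e₃ (s k)) := by
      intro k
      have hb' : algebraMap ℂ K b ≠ 0 := (map_ne_zero _).2 hb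
      rw [Pi.add_apply, Pi.smul_apply, Pi.smul_apply, Algebra.smul_def, Algebra.smul_def, map_div₀,
        map_neg]
      field_simp
      ring
    have h4 : aeval (a • e₂ + b • e₃) (∑ μ ∈ S, g μ * ∏ k, X (s k) ^ μ k) =
        algebraMap ℂ K (b ^ D) * (-algebraMap ℂ K b) ^ d * ∑ μ ∈ S,
          algebraMap ℂ K ((G μ).eval (-a / b)) *
            ∏ k, (algebraMap ℂ K (-a / b) * e₂ (s k) - e₃ (s k)) ^ μ k := by
      rw [map_sum, Finset.mul_sum]
      refine Finset.sum_congr rfl fun μ hμ => ?_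
      rw [map_mul, hg K μ hμ _ _ _ h2 h3, map_prod]
      simp only [map_pow, aeval_X, hk, mul_pow, Finset.prod_mul_distrib]
      rw [Finset.prod_pow_eq_pow_sum, hS μ hμ]
      ring
    rw [map_mul, h4, hG, mul_zero, mul_zero]
  -- `H` has smaller degree than `Υ` in the first variable
  have hH : H = 0 := by
    rw [hΥ, Ideal.mem_span_singleton] at hHN
    obtain ⟨Q, hQ⟩ := hHN
    -- Translation by T times the first basis vector: the degree in T is the degree in x₀. It is at
    -- most d for `H` and equals d + 1 for `Υ`, so the cofactor `Q` must vanish.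
    let L : MvPolynomial (Fin 4) ℂ →ₐ[ℂ] Polynomial (MvPolynomial (Fin 4) ℂ) :=
      aeval fun i => Polynomial.C (X i) + Polynomial.C (algebraMap ℂ (MvPolynomial (Fin 4) ℂ)
        ((Pi.single 0 1 : Fin 4 → ℂ) i)) * Polynomial.X
    have hL1 : (L Υ).natDegree ≤ d + 1 ∧ (L Υ).coeff (d + 1) = C (eval (Pi.single 0 1) Υ) :=
      aeval_line_natDegree_le_and_coeff X (Pi.single 0 1) hd
    have hLX : ∀ i, i ≠ 0 → L (X i) = Polynomial.C (X i) := by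
      intro i hi
      simp [L, hi]
    have hLg : ∀ μ, (L (g μ)).natDegree ≤ 0 := by
      intro μ
      rw [map_sum]
      refine Polynomial.natDegree_sum_le_of_forall_le _ _ fun k _ => ?_
      rw [map_mul, map_mul, map_pow, map_pow, map_neg, hLX 2 (by decide), hLX 3 (by decide),
        ← algebraMap_eq, AlgHom.commutes, Polynomial.algebraMap_apply]
      simp only [← map_neg, ← map_pow, ← map_mul]
      rw [Polynomial.natDegree_C]
    have hLH : (L H).natDegree ≤ d := by
      rw [map_mul, hLX 3 (by decide), map_sum]
      refine (Polynomial.natDegree_C_mul_le _ _).trans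
        (Polynomial.natDegree_sum_le_of_forall_le _ _ fun μ hμ => ?_)
      rw [map_mul, ← zero_add d]
      refine Polynomial.natDegree_mul_le_of_le (hLg μ) ?_
      rw [map_prod, ← hS μ hμ]
      refine (Polynomial.natDegree_prod_le _ _).trans (Finset.sum_le_sum fun k _ => ?_)
      rw [map_pow]
      refine Polynomial.natDegree_pow_le_of_le _ ?_ |>.trans_eq (mul_one _)
      simp only [L, aeval_X]
      compute_degree
    have hLΥ : (L Υ).coeff (d + 1) ≠ 0 := by
      rw [hL1.2]
      exact (map_ne_zero_iff C (C_injective _ _)).2 h0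
    have hdeg : d + 1 ≤ (L Υ).natDegree := Polynomial.le_natDegree_of_ne_zero hLΥ
    have hLQ : L Q = 0 := by
      by_contra hne
      have h1 := Polynomial.natDegree_mul (p := L Υ) (q := L Q)
        (fun h => hLΥ (by rw [h, Polynomial.coeff_zero])) hne
      rw [← map_mul, ← hQ] at h1
      omega
    have hL0 : ∀ f, (L f).eval 0 = f := by
      intro f
      have h : ((Polynomial.aeval (R := MvPolynomial (Fin 4) ℂ)
          (0 : MvPolynomial (Fin 4) ℂ)).restrictScalars ℂ).comp L = AlgHom.id ℂ _ := by
        ext i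
        simp [L]
      exact DFunLike.congr_fun h f
    rw [hQ, ← hL0 Q, hLQ, Polynomial.eval_zero, mul_zero]
  -- hence all coefficients vanish
  have hP : ∀ t : ℂ, ∑ μ ∈ S, monomial μ ((G μ).eval t) = 0 := by
    intro t
    have h1 : (X 2 : MvPolynomial (Fin 3) ℂ) * ∑ μ ∈ S, monomial μ ((G μ).eval t) = 0 := by
      apply MvPolynomial.funext
      intro w
      rw [map_mul, map_zero, eval_X]
      by_cases hw : w 2 = 0
      · rw [hw, zero_mul]
      have h2 : ∀ μ ∈ S, eval ![w 0, w 1, -(t * w 2), w 2] (g μ) = w 2 ^ D * (G μ).eval t :=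
        fun μ hμ => hg ℂ μ hμ _ t (w 2) rfl rfl
      have h3 : eval ![w 0, w 1, -(t * w 2), w 2] H = 0 := by rw [hH, map_zero]
      have h4 : ∀ k, ![w 0, w 1, -(t * w 2), w 2] (s k) = w k := by
        intro k
        fin_cases k <;> rfl
      rw [map_mul, map_sum] at h3
      rw [map_sum]
      have h5 : ∑ μ ∈ S, eval ![w 0, w 1, -(t * w 2), w 2] (g μ * ∏ k, X (s k) ^ μ k) =
          w 2 ^ D * ∑ μ ∈ S, eval w (monomial μ ((G μ).eval t)) := by
        rw [Finset.mul_sum]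
        refine Finset.sum_congr rfl fun μ hμ => ?_
        rw [map_mul, h2 μ hμ, map_prod, eval_monomial, Finsupp.prod_fintype _ _ (by simp)]
        simp only [map_pow, eval_X, h4]
        ring
      rw [h5, eval_X] at h3
      have h6 := (mul_eq_zero.1 ((mul_eq_zero.1 h3).resolve_left hw)).resolve_left
        (pow_ne_zero _ hw)
      rw [h6, mul_zero]
    exact (mul_eq_zero.1 h1).resolve_left (X_ne_zero _)
  intro μ hμ
  apply Polynomial.funext
  intro t
  have h1 := congrArg (coeff μ) (hP t)
  rw [coeff_sum, Finset.sum_eq_single μ, coeff_monomial, if_pos rfl, coeff_zero] at h1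
  · rw [h1, Polynomial.eval_zero]
  · intro ν _ hν
    rw [coeff_monomial, if_neg hν]
  · exact fun h => absurd hμ h

end

/-! ### Generic plane sections in adapted coordinates -/

section

variable {K : Type} [Field K] [Algebra ℂ K]

/-- The vector `β ω` lies in the given plane, is orthogonal to ω and has entries linear in ω. After
elimination of x₂, a form vanishing at it is a ℂ-relation between monomials of degree d in its other
three coordinates. Functionals from `K` to ℂ turn independence of these monomials into a nonzero
minor, polynomial in ω, and the pencil shows that some minor is not identically zero. -/
theorem exists_generic_section_of_coordinates {e₂ e₃ : Fin 4 → K} (h22 : e₂ 2 = 1) (h23 : e₂ 3 = 0)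
    (h32 : e₃ 2 = 0) (h33 : e₃ 3 = 1) {d : ℕ} {Υ : MvPolynomial (Fin 4) ℂ}
    (hΥ : vanishingOn (Submodule.span K {e₂, e₃}) = Ideal.span {Υ})
    (hd : Υ.IsHomogeneous (d + 1)) (h0 : eval (Pi.single 0 1) Υ ≠ 0) :
    ∃ G : MvPolynomial (Fin 4) ℂ, G ≠ 0 ∧ ∀ ω : Fin 4 → ℂ, eval ω G ≠ 0 →
      (∃ c, c ⬝ᵥ ω = 0 ∧ eval c Υ ≠ 0) ∧
      ∀ g : MvPolynomial (Fin 4) ℂ, g.IsHomogeneous d →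
        (∀ a ∈ Submodule.span K {e₂, e₃}, a ⬝ᵥ (fun i => algebraMap ℂ K (ω i)) = 0 →
          aeval a g = 0) →
        ∀ c, c ⬝ᵥ ω = 0 → eval c g = 0 := by
  let s : Fin 3 → Fin 4 := Fin.succAbove 2
  let ωK : (Fin 4 → ℂ) → Fin 4 → K := fun ω i => algebraMap ℂ K (ω i)
  let β : (Fin 4 → ℂ) → Fin 4 → K := fun ω => (e₃ ⬝ᵥ ωK ω) • e₂ - (e₂ ⬝ᵥ ωK ω) • e₃
  have hβ : ∀ ω, β ω ∈ Submodule.span K {e₂, e₃} := fun ω =>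
    Submodule.sub_mem _ (Submodule.smul_mem _ _ (Submodule.subset_span (by simp)))
      (Submodule.smul_mem _ _ (Submodule.subset_span (by simp)))
  have hβω : ∀ ω, β ω ⬝ᵥ ωK ω = 0 := by
    intro ω
    simp only [β, sub_dotProduct, smul_dotProduct, smul_eq_mul]
    ring
  let b : Fin 4 → MvPolynomial (Fin 4) K := fun i => ∑ j, X j * C (e₃ j * e₂ i - e₂ j * e₃ i)
  have hb : ∀ ω i, eval (ωK ω) (b i) = β ω i := by
    intro ω i
    simp only [b, β, dotProduct, map_sum, map_mul, eval_X, eval_C, Pi.sub_apply, Pi.smul_apply,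
      smul_eq_mul, Finset.sum_mul, ← Finset.sum_sub_distrib]
    exact Finset.sum_congr rfl fun j _ => by ring
  choose F hF using fun (μ : Fin 3 →₀ ℕ) (ψ : K →ₗ[ℂ] ℂ) =>
    exists_forall_eval_eq ψ (∏ k, b (s k) ^ μ k)
  have hF' : ∀ μ ψ ω, eval ω (F μ ψ) = ψ (∏ k, β ω (s k) ^ μ k) := by
    intro μ ψ ω
    rw [hF, map_prod]
    congr 2
    funext k
    rw [map_pow]
    exact congrArg (· ^ μ k) (hb ω (s k))
  let S : Finset (Fin 3 →₀ ℕ) := Finset.finsuppAntidiag Finset.univ d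
  have hS : ∀ μ, μ ∈ S ↔ ∑ k, μ k = d := by
    intro μ
    simp [S, Finset.mem_finsuppAntidiag]
  -- The pencil ω = (0, 0, 1, t), on which `β ω` is t e₂ - e₃.
  let p : Fin 4 → Polynomial ℂ := ![0, 0, 1, Polynomial.X]
  have hp : ∀ (t : ℂ) f, (aeval p f).eval t = eval ![0, 0, 1, t] f := by
    intro t f
    rw [eval_aeval_polynomial]
    congr 2
    funext i
    fin_cases i <;> simp [p]
  have hβp : ∀ (t : ℂ) i, β ![0, 0, 1, t] i = algebraMap ℂ K t * e₂ i - e₃ i := by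
    intro t i
    simp [β, ωK, dotProduct, Fin.sum_univ_four, h22, h23, h32, h33]
  have hind : LinearIndepOn (Polynomial ℂ) (fun (μ : Fin 3 →₀ ℕ) ψ => aeval p (F μ ψ))
      (S : Set (Fin 3 →₀ ℕ)) := by
    rw [linearIndepOn_finset_iff]
    intro G hG
    refine eq_zero_of_forall_pencil h22 h23 h32 h33 hΥ hd h0 (fun μ hμ => (hS μ).1 hμ) G
      fun t => ?_
    rw [← Module.forall_dual_apply_eq_zero_iff ℂ]
    intro ψ
    have h1 := congrArg (Polynomial.eval t) (congrFun hG ψ)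
    rw [Finset.sum_apply, Polynomial.eval_finsetSum, Pi.zero_apply, Polynomial.eval_zero] at h1
    rw [← h1, map_sum]
    refine Finset.sum_congr rfl fun μ _ => ?_
    rw [← Algebra.smul_def, map_smul, Pi.smul_apply, smul_eq_mul, smul_eq_mul, Polynomial.eval_mul,
      hp, hF']
    simp only [hβp]
    rfl
  let u : Fin S.card → (Fin 3 →₀ ℕ) := fun i => S.equivFin.symm i
  obtain ⟨ψ, hψ⟩ := exists_minor_ne_zero (fun i ψ => aeval p (F (u i) ψ))
    (LinearIndependent.comp hind S.equivFin.symm S.equivFin.symm.injective)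
  let A : Matrix (Fin S.card) (Fin S.card) (MvPolynomial (Fin 4) ℂ) :=
    Matrix.of fun i j => F (u i) (ψ j)
  have hA : A.det ≠ 0 := by
    intro h
    apply hψ
    have h1 := congrArg (aeval p) h
    rwa [map_zero, AlgHom.map_det] at h1
  -- The value of `Υ` at (ω₂, 0, -ω₀, 0), a vector orthogonal to ω. It is not identically zero: ω =
  -- (0, 0, 1, 0) gives `Υ` at (1, 0, 0, 0).
  let Υ₁ : MvPolynomial (Fin 4) ℂ := aeval ![X 2, 0, -X 0, 0] Υ
  have hΥ₁ : ∀ ω, eval ω Υ₁ = eval ![ω 2, 0, -ω 0, 0] Υ := by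
    intro ω
    have h : (aeval (R := ℂ) ω).comp (aeval ![X 2, 0, -X 0, 0] : MvPolynomial (Fin 4) ℂ →ₐ[ℂ] _) =
        aeval ![ω 2, 0, -ω 0, 0] := by
      ext i
      fin_cases i <;> simp
    exact DFunLike.congr_fun h Υ
  have hΥ₁0 : Υ₁ ≠ 0 := by
    intro h
    apply h0
    have h1 := hΥ₁ ![0, 0, 1, 0]
    rw [h, map_zero] at h1
    rw [h1]
    congr 2
    funext i
    fin_cases i <;> simp
  refine ⟨A.det * X 2 * Υ₁, mul_ne_zero (mul_ne_zero hA (X_ne_zero _)) hΥ₁0, fun ω hω => ?_⟩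
  rw [map_mul, map_mul, eval_X, mul_ne_zero_iff, mul_ne_zero_iff] at hω
  obtain ⟨⟨hωA, hω2⟩, hωΥ⟩ := hω
  refine ⟨⟨_, ?_, hΥ₁ ω ▸ hωΥ⟩, ?_⟩
  · simp [dotProduct, Fin.sum_univ_four]
    ring
  intro g hg hgN c hc
  -- eliminate the third variable on the hyperplane
  let R : Matrix (Fin 4) (Fin 3) ℂ :=
    Matrix.of fun i j => Fin.insertNth (α := fun _ => ℂ) 2 (-ω (s j) / ω 2)
      (Pi.single j (1 : ℂ)) i
  have hR : ∀ {L : Type} [Field L] [Algebra ℂ L] (a : Fin 4 → L),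
      a ⬝ᵥ (fun i => algebraMap ℂ L (ω i)) = 0 →
      (R.map (algebraMap ℂ L)).mulVec (fun k => a (s k)) = a := by
    intro L _ _ a ha
    have hω2' : algebraMap ℂ L (ω 2) ≠ 0 := (map_ne_zero _).2 hω2
    simp only [dotProduct, Fin.sum_univ_succAbove _ (2 : Fin 4), Fin.sum_univ_three] at ha
    funext i
    refine Fin.succAboveCases 2 ?_ (fun k => ?_) i
    · simp only [R, Matrix.mulVec, dotProduct, Fin.sum_univ_three, Matrix.map_apply,
        Matrix.of_apply, Fin.insertNth_apply_same, map_div₀, map_neg]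
      field_simp
      linear_combination -ha
    · simp [R, Matrix.mulVec, dotProduct, Pi.single_apply, s]
  let g' := pullback R g
  have hg' : g'.IsHomogeneous d := isHomogeneous_pullback R hg
  have hg'S : g' = ∑ μ ∈ S, monomial μ (coeff μ g') := by
    conv_lhs => rw [g'.as_sum]
    refine Finset.sum_subset (fun μ hμ => ?_) (fun μ _ hμ => ?_)
    · rw [hS, ← Finsupp.degree_eq_sum]
      by_contra h
      exact mem_support_iff.1 hμ (hg'.coeff_eq_zero h)
    · rw [notMem_support_iff.1 hμ, monomial_zero]
  have hrel : ∑ μ ∈ S, algebraMap ℂ K (coeff μ g') * ∏ k, β ω (s k) ^ μ k = 0 := by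
    have h1 : aeval (β ω) g = aeval (fun k => β ω (s k)) g' := by
      rw [aeval_pullback, hR _ (hβω ω)]
    rw [← hgN _ (hβ ω) (hβω ω), h1]
    conv_rhs => rw [hg'S, map_sum]
    refine Finset.sum_congr rfl fun μ _ => ?_
    rw [aeval_monomial, Finsupp.prod_fintype _ _ (by simp)]
  have hvec : Matrix.vecMul (fun i => coeff (u i) g') (A.map (eval ω)) = 0 := by
    funext j
    have h1 := congrArg (ψ j) hrel
    rw [map_sum, map_zero] at h1
    rw [Pi.zero_apply, ← h1, ← Finset.sum_coe_sort S,
      ← Equiv.sum_comp S.equivFin.symm]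
    change ∑ i, coeff (u i) g' * eval ω (F (u i) (ψ j)) = _
    refine Finset.sum_congr rfl fun i _ => ?_
    rw [← Algebra.smul_def, map_smul, smul_eq_mul, ← hF']
  have hdet : (A.map (eval ω)).det ≠ 0 := by
    have h1 := RingHom.map_det (eval ω) A
    rw [RingHom.mapMatrix_apply] at h1
    rwa [← h1]
  have hcoeff := Matrix.eq_zero_of_vecMul_eq_zero hdet hvec
  have hg'0 : g' = 0 := by
    rw [hg'S]
    refine Finset.sum_eq_zero fun μ hμ => ?_
    have h1 := congrFun hcoeff (S.equivFin ⟨μ, hμ⟩)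
    simp only [u, Equiv.symm_apply_apply, Pi.zero_apply] at h1
    rw [h1, monomial_zero]
  have h1 := hR (L := ℂ) c hc
  rw [← h1]
  have h2 := aeval_pullback (K := ℂ) R g fun k => c (s k)
  rw [show pullback R g = 0 from hg'0, map_zero] at h2
  exact h2.symm

end

/-! ### Generic plane sections: reduction to adapted coordinates -/

section

variable {K : Type} [Field K] [Algebra ℂ K]

/-- Let the ideal of the forms vanishing on a plane `N` be generated by a form `Υ`. On a generic
complex hyperplane, no nonzero form of degree smaller than that of `Υ` vanishes on the
intersection with `N`. -/
theorem exists_generic_section {N : Submodule K (Fin 4 → K)} (hN : Module.finrank K N = 2)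
    {d : ℕ} {Υ : MvPolynomial (Fin 4) ℂ} (hΥ : vanishingOn N = Ideal.span {Υ})
    (hd : Υ.IsHomogeneous (d + 1)) (hΥ0 : Υ ≠ 0) :
    ∃ G : MvPolynomial (Fin 4) ℂ, G ≠ 0 ∧ ∀ ω : Fin 4 → ℂ, eval ω G ≠ 0 →
      (∃ c, c ⬝ᵥ ω = 0 ∧ eval c Υ ≠ 0) ∧
      ∀ g : MvPolynomial (Fin 4) ℂ, g.IsHomogeneous d →
        (∀ a ∈ N, a ⬝ᵥ (fun i => algebraMap ℂ K (ω i)) = 0 → aeval a g = 0) →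
        ∀ c, c ⬝ᵥ ω = 0 → eval c g = 0 := by
  -- As the first basis vector, `c₁` makes `Υ` have full degree in x₀. Its `K`-line meets `N` only
  -- in 0, because `Υ` is homogeneous and vanishes on `N`.
  obtain ⟨c₁, hc₁⟩ : ∃ c, eval c Υ ≠ 0 := by
    by_contra! h
    exact hΥ0 (MvPolynomial.funext fun c => by rw [h, map_zero])
  let toK : (Fin 4 → ℂ) → Fin 4 → K := fun v i => algebraMap ℂ K (v i)
  have hc₁N : ∀ t : K, t • toK c₁ ∈ N → t = 0 := by
    intro t ht
    have h1 : Υ ∈ vanishingOn N := hΥ ▸ Ideal.mem_span_singleton_self Υ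
    have h2 := h1 _ ht
    rw [aeval_smul_of_isHomogeneous hd] at h2
    have h3 : aeval (toK c₁) Υ = algebraMap ℂ K (eval c₁ Υ) := by
      rw [← aeval_eq_eval]
      exact aeval_algebraMap_apply K c₁ Υ
    rw [h3] at h2
    exact eq_zero_of_pow_eq_zero ((mul_eq_zero.1 h2).resolve_right ((map_ne_zero _).2 hc₁))
  -- With `c₂`, the `K`-span of both vectors is complementary to `N`, so in a basis starting with
  -- them `N` projects isomorphically to the last two coordinates.
  obtain ⟨c₂, hc₂⟩ : ∃ c₂ : Fin 4 → ℂ, toK c₂ ∉ N ⊔ Submodule.span K {toK c₁} := by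
    by_contra! h
    have htop : N ⊔ Submodule.span K {toK c₁} = ⊤ := by
      rw [eq_top_iff, ← (Pi.basisFun K (Fin 4)).span_eq, Submodule.span_le]
      rintro _ ⟨i, rfl⟩
      have h1 := h (Pi.single i 1)
      have h2 : toK (Pi.single i 1) = Pi.basisFun K (Fin 4) i := by
        funext j
        simp [toK, Pi.single_apply, apply_ite (algebraMap ℂ K)]
      rwa [h2] at h1
    have h1 := Submodule.finrank_add_le_finrank_add_finrank N (Submodule.span K {toK c₁})
    rw [htop, finrank_top, hN] at h1
    have h2 : toK c₁ ≠ 0 := fun h2 => one_ne_zero (hc₁N 1 (by rw [h2, smul_zero]; exact N.zero_mem))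
    rw [finrank_span_singleton h2, Module.finrank_fin_fun] at h1
    omega
  have hlin : ∀ s t : K, s • toK c₁ + t • toK c₂ ∈ N → s = 0 ∧ t = 0 := by
    intro s t hst
    have ht : t = 0 := by
      by_contra ht
      apply hc₂
      have h1 : toK c₂ = t⁻¹ • (s • toK c₁ + t • toK c₂) + -(t⁻¹ * s) • toK c₁ := by
        rw [smul_add, smul_smul, smul_smul, inv_mul_cancel₀ ht]
        module
      rw [h1]
      exact Submodule.add_mem_sup (N.smul_mem _ hst)
        (Submodule.smul_mem _ _ (Submodule.mem_span_singleton_self _))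
    subst ht
    rw [zero_smul, add_zero] at hst
    exact ⟨hc₁N s hst, rfl⟩
  have hc : LinearIndependent ℂ ![c₁, c₂] := by
    rw [LinearIndependent.pair_iff]
    intro s t hst
    have h1 : algebraMap ℂ K s • toK c₁ + algebraMap ℂ K t • toK c₂ = 0 := by
      funext i
      have h2 := congrArg (algebraMap ℂ K) (congrFun hst i)
      simp only [Pi.add_apply, Pi.smul_apply, smul_eq_mul, map_add, map_mul, Pi.zero_apply,
        map_zero] at h2
      exact h2
    have h2 := hlin _ _ (h1 ▸ N.zero_mem)
    exact ⟨(map_eq_zero _).1 h2.1, (map_eq_zero _).1 h2.2⟩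
  obtain ⟨c₃, hc₃⟩ := exists_linearIndependent_snoc_of_lt_finrank hc
    (by simp only [Module.finrank_fin_fun]; omega)
  obtain ⟨c₄, hc₄⟩ := exists_linearIndependent_snoc_of_lt_finrank hc₃
    (by simp only [Module.finrank_fin_fun]; omega)
  let w : Fin 4 → Fin 4 → ℂ := Fin.snoc (Fin.snoc ![c₁, c₂] c₃ : Fin 3 → Fin 4 → ℂ) c₄
  have hw0 : w 0 = c₁ := rfl
  have hw1 : w 1 = c₂ := rfl
  have hunit : IsUnit (Matrix.of w).transpose := by
    rw [Matrix.isUnit_transpose, ← Matrix.linearIndependent_rows_iff_isUnit]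
    exact hc₄
  let C₀ : Matrix (Fin 4) (Fin 4) ℂ := (Matrix.of w).transpose
  obtain ⟨D, hCD, hDC⟩ := isUnit_iff_exists.1 hunit
  change C₀ * D = 1 at hCD
  change D * C₀ = 1 at hDC
  let CK := C₀.map (algebraMap ℂ K)
  let DK := D.map (algebraMap ℂ K)
  have hCDK : CK * DK = 1 := by
    rw [← Matrix.map_mul, hCD]
    simp
  have hDCK : DK * CK = 1 := by
    rw [← Matrix.map_mul, hDC]
    simp
  have hCDv : ∀ v, CK.mulVec (DK.mulVec v) = v := fun v => by
    rw [Matrix.mulVec_mulVec, hCDK, Matrix.one_mulVec]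
  have hDCv : ∀ v, DK.mulVec (CK.mulVec v) = v := fun v => by
    rw [Matrix.mulVec_mulVec, hDCK, Matrix.one_mulVec]
  have hCv : ∀ z : Fin 4 → K, z 2 = 0 → z 3 = 0 →
      CK.mulVec z = z 0 • toK c₁ + z 1 • toK c₂ := by
    intro z h2 h3
    funext i
    simp [CK, C₀, Matrix.mulVec, dotProduct, Fin.sum_univ_four, h2, h3, hw0, hw1, toK, mul_comm]
  let θ : N →ₗ[K] (Fin 2 → K) :=
    (LinearMap.funLeft K K ![(2 : Fin 4), 3]).comp (DK.mulVecLin.comp N.subtype)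
  have hθ0 : ∀ n : N, θ n 0 = DK.mulVec n 2 := fun n => rfl
  have hθ1 : ∀ n : N, θ n 1 = DK.mulVec n 3 := fun n => rfl
  have hθinj : Function.Injective θ := by
    rw [injective_iff_map_eq_zero]
    intro n hn
    have h0 : CK.mulVec (DK.mulVec n) ∈ N := by
      rw [hCDv]
      exact n.2
    have h2 : DK.mulVec (n : Fin 4 → K) 2 = 0 := congrFun hn 0
    have h3 : DK.mulVec (n : Fin 4 → K) 3 = 0 := congrFun hn 1
    rw [hCv _ h2 h3] at h0
    obtain ⟨h4, h5⟩ := hlin _ _ h0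
    have h6 := hCv _ h2 h3
    rw [h4, h5, zero_smul, zero_smul, add_zero, hCDv] at h6
    exact Subtype.ext h6
  have hθsurj : Function.Surjective θ :=
    (LinearMap.injective_iff_surjective_of_finrank_eq_finrank (by simp [hN])).1 hθinj
  obtain ⟨n₂, hn₂⟩ := hθsurj ![1, 0]
  obtain ⟨n₃, hn₃⟩ := hθsurj ![0, 1]
  let e₂ := DK.mulVec (n₂ : Fin 4 → K)
  let e₃ := DK.mulVec (n₃ : Fin 4 → K)
  have hN' : ∀ a, a ∈ Submodule.span K {e₂, e₃} ↔ CK.mulVec a ∈ N := by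
    intro a
    constructor
    · intro ha
      obtain ⟨s, t, rfl⟩ := Submodule.mem_span_pair.1 ha
      rw [Matrix.mulVec_add, Matrix.mulVec_smul, Matrix.mulVec_smul, hCDv, hCDv]
      exact N.add_mem (N.smul_mem _ n₂.2) (N.smul_mem _ n₃.2)
    · intro ha
      have h1 : (⟨CK.mulVec a, ha⟩ : N) = a 2 • n₂ + a 3 • n₃ := by
        apply hθinj
        rw [map_add, map_smul, map_smul, hn₂, hn₃]
        funext i
        fin_cases i
        · simp [hθ0, hDCv]
        · simp [hθ1, hDCv]
      have h2 := congrArg (fun n : N => DK.mulVec (n : Fin 4 → K)) h1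
      simp only [hDCv, Submodule.coe_add, Submodule.coe_smul, Matrix.mulVec_add,
        Matrix.mulVec_smul] at h2
      rw [h2]
      exact Submodule.mem_span_pair.2 ⟨_, _, rfl⟩
  have hpull : ∀ {A B : Matrix (Fin 4) (Fin 4) ℂ}, B * A = 1 → ∀ f, pullback A (pullback B f) = f := by
    intro A B hBA f
    apply MvPolynomial.funext
    intro v
    rw [eval_pullback, eval_pullback, Matrix.mulVec_mulVec, hBA, Matrix.one_mulVec]
  have hΥ' : vanishingOn (Submodule.span K {e₂, e₃}) = Ideal.span {pullback C₀ Υ} := by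
    ext f
    have h1 : f ∈ vanishingOn (Submodule.span K {e₂, e₃}) ↔ pullback D f ∈ vanishingOn N := by
      rw [mem_vanishingOn, mem_vanishingOn]
      constructor
      · intro h n hn
        rw [aeval_pullback]
        refine h _ ((hN' _).2 ?_)
        rwa [hCDv]
      · intro h a ha
        have h2 := h _ ((hN' a).1 ha)
        rwa [aeval_pullback, hDCv] at h2
    rw [h1, hΥ, Ideal.mem_span_singleton, Ideal.mem_span_singleton]
    constructor
    · intro h
      rw [← hpull hDC f]
      exact map_dvd _ h
    · intro h
      rw [← hpull hCD Υ]
      exact map_dvd _ h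
  have h0 : eval (Pi.single 0 1) (pullback C₀ Υ) ≠ 0 := by
    rw [eval_pullback, Matrix.mulVec_single_one]
    exact hc₁
  obtain ⟨G, hG0, hG⟩ := exists_generic_section_of_coordinates (e₂ := e₂) (e₃ := e₃)
    (congrFun hn₂ 0) (congrFun hn₂ 1) (congrFun hn₃ 0) (congrFun hn₃ 1) hΥ'
    (isHomogeneous_pullback C₀ hd) h0
  refine ⟨pullback C₀.transpose G, fun h => hG0 ?_, fun ω hω => ?_⟩
  · rw [← hpull (A := D.transpose) (B := C₀.transpose)
      (by rw [← Matrix.transpose_mul, hDC, Matrix.transpose_one]) G, h, map_zero]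
  rw [eval_pullback] at hω
  obtain ⟨⟨c, hc, hcΥ⟩, hg⟩ := hG _ hω
  refine ⟨⟨C₀.mulVec c, ?_, ?_⟩, fun g hgd hgN c hcω => ?_⟩
  · rwa [Matrix.dotProduct_mulVec, Matrix.vecMul_transpose] at hc
  · rwa [eval_pullback] at hcΥ
  have h1 := hg (pullback C₀ g) (isHomogeneous_pullback C₀ hgd) ?_ (D.mulVec c) ?_
  · rwa [eval_pullback, Matrix.mulVec_mulVec, hCD, Matrix.one_mulVec] at h1
  · intro a ha haω
    rw [aeval_pullback]
    refine hgN _ ((hN' a).1 ha) ?_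
    have h2 : (fun i => algebraMap ℂ K (C₀.transpose.mulVec ω i)) = CK.transpose.mulVec (toK ω) := by
      funext i
      exact RingHom.map_mulVec (algebraMap ℂ K) _ _ i
    rwa [h2, Matrix.dotProduct_mulVec, Matrix.vecMul_transpose] at haω
  · rw [Matrix.dotProduct_mulVec, Matrix.vecMul_transpose, Matrix.mulVec_mulVec, hCD,
      Matrix.one_mulVec, hcω]

end

section

variable {K : Type} [Field K] [Algebra ℂ K]

/-! ### The class of a projection -/

/-- The image of 1 - BM lies in the line of O, so its transpose kills everything orthogonal to O. -/
theorem transpose_mulVec_transpose_mulVec {M : Matrix (Fin 3) (Fin 4) ℂ} {O : PSpace 3}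
    (hM : HasCentre M O) {B : Matrix (Fin 4) (Fin 3) ℂ} (hB : M * B = 1) {a : Fin 4 → K}
    (ha : a ⬝ᵥ (fun i => algebraMap ℂ K (O.rep i)) = 0) :
    (M.transpose.map (algebraMap ℂ K)).mulVec ((B.transpose.map (algebraMap ℂ K)).mulVec a) = a := by
  have h : ∀ j, ∃ c : ℂ, (1 - B * M).mulVec (Pi.single j 1) = c • O.rep := by
    intro j
    apply exists_eq_smul_of_mulVec_eq_zero hM
    rw [Matrix.mulVec_mulVec, Matrix.mul_sub, ← Matrix.mul_assoc, hB, Matrix.mul_one,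
      Matrix.one_mul, sub_self, Matrix.zero_mulVec]
  choose l hl using h
  have hBM : B * M = 1 - Matrix.of fun i j => l j * O.rep i := by
    ext i j
    have h1 := congrFun (hl j) i
    rw [Matrix.mulVec_single_one] at h1
    change (1 : Matrix _ _ ℂ) i j - (B * M) i j = l j * O.rep i at h1
    rw [Matrix.sub_apply, Matrix.of_apply, ← h1]
    ring
  rw [Matrix.mulVec_mulVec, ← Matrix.map_mul, ← Matrix.transpose_mul, hBM]
  funext j
  have h1 : ∑ i, l j • (a i * algebraMap ℂ K (O.rep i)) = 0 := by
    rw [← Finset.smul_sum]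
    exact (congrArg (l j • ·) ha).trans (smul_zero _)
  rw [← sub_eq_zero, ← neg_eq_zero, ← h1]
  simp only [Matrix.mulVec, dotProduct, Matrix.map_apply, Matrix.transpose_apply, Matrix.sub_apply,
    Matrix.of_apply, map_sub, map_mul, sub_mul, Finset.sum_sub_distrib, Matrix.one_apply,
    apply_ite (algebraMap ℂ K), map_one, map_zero, ite_mul, one_mul, zero_mul, Finset.sum_ite_eq',
    Finset.mem_univ, if_true, Algebra.smul_def]
  rw [sub_sub_cancel_left, neg_neg]
  exact Finset.sum_congr rfl fun i _ => by ring

/-- Pullback along the transposes of M and of its right inverse B moves forms between the dual plane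
and the plane orthogonal to O, where the two parts of `hsec` give the two inequalities. `hlin` keeps
the projection from being a line, whose dual would not be a curve. -/
theorem hasClass_projection {X : Set (PSpace 3)} (hX : IsIrreducibleCurve X) {ξ : Fin 4 → K}
    (hξ : IsGenericPoint (idealOf X) ξ) (hK : Algebra.trdeg ℂ K = 2)
    {M : Matrix (Fin 3) (Fin 4) ℂ} {O : PSpace 3} (hM : HasCentre M O) (hO : O ∉ X)
    (hgen : ∃ a ∈ conormal (idealOf X) ξ, a ⬝ᵥ (fun i => algebraMap ℂ K (O.rep i)) ≠ 0)
    (hlin : ∀ w : Fin 4 → ℂ, w ≠ 0 → linForm w ∈ idealOf X → w ⬝ᵥ O.rep ≠ 0)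
    {d : ℕ} {Υ : MvPolynomial (Fin 4) ℂ} (hd : Υ.IsHomogeneous (d + 1))
    (hΥ : Υ ∈ vanishingOn (conormal (idealOf X) ξ))
    (hsec : (∃ c, c ⬝ᵥ O.rep = 0 ∧ eval c Υ ≠ 0) ∧
      ∀ g : MvPolynomial (Fin 4) ℂ, g.IsHomogeneous d →
        (∀ a ∈ conormal (idealOf X) ξ, a ⬝ᵥ (fun i => algebraMap ℂ K (O.rep i)) = 0 →
          aeval a g = 0) →
        ∀ c, c ⬝ᵥ O.rep = 0 → eval c g = 0) :
    HasClass (projection M X) (d + 1) := by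
  have hY := isIrreducibleCurve_projection hX hM hO
  have hMO := mulVec_rep_centre hM
  obtain ⟨B, hB⟩ := exists_right_inverse_of_hasCentre hM
  have hBM : ∀ b : Fin 3 → ℂ, B.transpose.mulVec (M.transpose.mulVec b) = b := by
    intro b
    rw [Matrix.mulVec_mulVec, ← Matrix.transpose_mul, hB, Matrix.transpose_one, Matrix.one_mulVec]
  have hMT : ∀ b : Fin 3 → ℂ, M.transpose.mulVec b ⬝ᵥ O.rep = 0 := by
    intro b
    rw [Matrix.mulVec_transpose, ← Matrix.dotProduct_mulVec, hMO, dotProduct_zero]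
  have hlinY : ∀ r, r + 1 = 2 → ∀ v : Fin r → Fin (2 + 1) → ℂ, LinearIndependent ℂ v →
      ∃ k, linForm (v k) ∉ idealOf (projection M X) := by
    intro r hr v hv
    obtain rfl : r = 1 := by omega
    refine ⟨0, fun h => ?_⟩
    rw [mem_idealOf_projection hM hO] at h
    have h1 : pullback M (linForm (v 0)) = linForm (n := 3) (M.transpose.mulVec (v 0)) := by
      apply MvPolynomial.funext
      intro w
      rw [eval_pullback, eval_linForm, eval_linForm, Matrix.mulVec_transpose,
        ← Matrix.dotProduct_mulVec]
    rw [h1] at h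
    refine hlin _ (fun h2 => hv.ne_zero 0 ?_) h (hMT _)
    rw [← hBM (v 0), h2, Matrix.mulVec_zero]
  obtain ⟨q, hq0, hq⟩ := exists_generator_idealOf_dualVariety hY le_rfl hlinY
  have hqmin := isMinimalEquation_of_idealOf_eq_span (zariskiClosure_dualVariety _) hq0 hq
  refine ⟨q, hqmin, ?_⟩
  rw [idealOf_dualVariety hY le_rfl (hξ.projection hM hO)] at hq
  have hqN : q ∈ vanishingOn _ := hq ▸ Ideal.mem_span_singleton_self q
  have hcon := fun b => mem_conormal_projection_iff hX hξ hK hM hO hgen (b := b)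
  apply le_antisymm
  · have h1 : pullback M.transpose Υ ∈ vanishingOn (conormal (idealOf (projection M X))
        ((M.map (algebraMap ℂ K)).mulVec ξ)) := by
      intro b hb
      rw [aeval_pullback]
      exact hΥ _ ((hcon b).1 hb)
    rw [hq, Ideal.mem_span_singleton] at h1
    have h2 : pullback M.transpose Υ ≠ 0 := by
      intro h2
      obtain ⟨c, hc, hcΥ⟩ := hsec.1
      apply hcΥ
      have h3 : M.transpose.mulVec (B.transpose.mulVec c) = c :=
        transpose_mulVec_transpose_mulVec (K := ℂ) hM hB hc
      rw [← h3, ← eval_pullback, h2, map_zero]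
    exact (totalDegree_le_of_dvd_of_isDomain h1 h2).trans
      (isHomogeneous_pullback _ hd).totalDegree_le
  · by_contra! hlt
    -- `hsec` speaks of degree exactly d, so an equation of smaller degree is padded with a power of
    -- a variable.
    have hqd : (q * MvPolynomial.X 0 ^ (d - q.totalDegree)).IsHomogeneous d := by
      have h1 := hqmin.1.2.1.mul ((isHomogeneous_X ℂ (0 : Fin 3)).pow (d - q.totalDegree))
      rwa [one_mul, Nat.add_sub_cancel' (Nat.lt_succ_iff.1 hlt)] at h1
    have h1 := hsec.2 _ (isHomogeneous_pullback B.transpose hqd) fun a ha hao => by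
      rw [aeval_pullback, map_mul, hqN _ ((hcon _).2 ?_), zero_mul]
      rwa [← Matrix.transpose_map, transpose_mulVec_transpose_mulVec hM hB hao]
    have h2 : q * MvPolynomial.X 0 ^ (d - q.totalDegree) = 0 := by
      apply MvPolynomial.funext
      intro b
      have h3 := h1 _ (hMT b)
      rwa [eval_pullback, hBM] at h3
    exact mul_ne_zero hq0 (pow_ne_zero _ (X_ne_zero 0)) h2

/-! ### Generic centres -/

/-- `G` need not be homogeneous: where a nonzero component of `G` does not vanish, `G` is nonzero at
some nonzero multiple of the representative. Hence the scalar in the hypothesis. -/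
theorem holdsGenerically_of_polynomial {n : ℕ} {P : PSpace n → Prop}
    {G : MvPolynomial (Fin (n + 1)) ℂ} (hG : G ≠ 0)
    (h : ∀ (p : PSpace n) (c : ℂ), c ≠ 0 → eval (c • p.rep) G ≠ 0 → P p) :
    HoldsGenerically P := by
  obtain ⟨d, hd⟩ : ∃ d, homogeneousComponent d G ≠ 0 := by
    by_contra! h0
    apply hG
    rw [← sum_homogeneousComponent G]
    exact Finset.sum_eq_zero fun d _ => h0 d
  have hhom := homogeneousComponent_isHomogeneous d G
  refine ⟨homogeneousComponent d G, hd, by rwa [hhom.totalDegree hd], fun p hp => ?_⟩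
  by_contra hP
  apply hp
  refine aeval_homogeneousComponent_eq_zero (K := ℂ) (fun c hc => ?_) d
  by_contra h1
  exact hP (h p c hc h1)

/-- Two independent linear equations would make X a line, so X lies in at most one plane, and a
centre off that plane suffices. -/
theorem exists_forall_linForm_mem {X : Set (PSpace 3)} (hX : IsIrreducibleCurve X)
    (hline : ¬ IsLine X) :
    ∃ G : MvPolynomial (Fin 4) ℂ, G ≠ 0 ∧ ∀ o, eval o G ≠ 0 →
      ∀ w : Fin 4 → ℂ, w ≠ 0 → linForm w ∈ idealOf X → w ⬝ᵥ o ≠ 0 := by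
  by_cases h : ∃ u : Fin 4 → ℂ, u ≠ 0 ∧ linForm u ∈ idealOf X
  · obtain ⟨u, hu, huX⟩ := h
    refine ⟨linForm u, fun h0 => hu ?_, fun o ho w hw hwX => ?_⟩
    · funext i
      have h1 := eval_linForm u (Pi.single i 1)
      rw [h0, map_zero, dotProduct_single_one] at h1
      exact h1.symm
    · rw [eval_linForm] at ho
      obtain ⟨c, hc⟩ : ∃ c : ℂ, c • u = w := by
        by_contra! h
        refine hline (isLine_of_linForm_mem hX (r := 2) rfl ![u, w]
          ((LinearIndependent.pair_iff' hu).2 h) fun k => ?_)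
        fin_cases k
        · exact huX
        · exact hwX
      subst hc
      rw [smul_dotProduct, smul_eq_mul]
      exact mul_ne_zero (fun hc => hw (by rw [hc, zero_smul])) ho
  · push Not at h
    exact ⟨1, one_ne_zero, fun _ _ w hw hwX => absurd hwX (h w hw)⟩

/-- Orthogonality of o to a gradient at `ξ` would persist at every complex point of X, so it is
excluded by the gradient at a single point. -/
theorem exists_generic_centre {X : Set (PSpace 3)} {ξ : Fin 4 → K}
    (hξ : IsGenericPoint (idealOf X) ξ) (hN : Module.finrank K (conormal (idealOf X) ξ) ≠ 0) :
    ∃ G : MvPolynomial (Fin 4) ℂ, G ≠ 0 ∧ ∀ o, eval o G ≠ 0 → o ∉ cone X ∧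
      ∃ a ∈ conormal (idealOf X) ξ, a ⬝ᵥ (fun i => algebraMap ℂ K (o i)) ≠ 0 := by
  obtain ⟨f, hf, i, hi⟩ : ∃ f ∈ idealOf X, ∃ i, pderiv i f ∉ idealOf X := by
    by_contra! h
    apply hN
    have h1 : conormal (idealOf X) ξ = ⊥ := by
      rw [conormal, Submodule.span_eq_bot]
      rintro _ ⟨f, hf, rfl⟩
      funext i
      exact (hξ _).1 (h f hf i)
    rw [h1, finrank_bot]
  obtain ⟨p, hp, hpi⟩ : ∃ p ∈ cone X, eval p (pderiv i f) ≠ 0 := by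
    by_contra! h
    exact hi h
  refine ⟨f * linForm fun j => eval p (pderiv j f), mul_ne_zero ?_ ?_, fun o ho => ?_⟩
  · rintro rfl
    exact hpi (by rw [map_zero, map_zero])
  · intro h0
    have h1 := eval_linForm (fun j => eval p (pderiv j f)) (Pi.single i 1)
    rw [h0, map_zero, dotProduct_single_one] at h1
    exact hpi h1.symm
  rw [map_mul, mul_ne_zero_iff, eval_linForm] at ho
  refine ⟨fun hoX => ho.1 (hf o hoX), grad ξ f, Submodule.subset_span ⟨f, hf, rfl⟩, fun h => ho.2 ?_⟩
  have h1 : ∑ j, pderiv j f * C (o j) ∈ idealOf X := by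
    rw [hξ, map_sum, ← h]
    simp [dotProduct, grad]
  have h2 : eval p _ = 0 := h1 p hp
  rw [map_sum] at h2
  rw [← h2]
  simp [dotProduct]

end

end SpaceCurve

/-! ### The degree of the dual surface and the class of generic projections -/

theorem mainTheorem9 (X : Set (SpaceCurve.PSpace 3)) (hX : SpaceCurve.IsIrreducibleCurve X)
    (hline : ¬ SpaceCurve.IsLine X) :
    ∃ m : ℕ,
      SpaceCurve.HoldsGenerically (fun O : SpaceCurve.PSpace 3 =>
        O ∉ X ∧ ∀ M : Matrix (Fin 3) (Fin 4) ℂ, SpaceCurve.HasCentre M O →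
          SpaceCurve.IsIrreducibleCurve (SpaceCurve.projection M X) ∧
          SpaceCurve.HasClass (SpaceCurve.projection M X) m) ∧
      (∃ Υ : MvPolynomial (Fin 4) ℂ,
        SpaceCurve.IsMinimalEquation Υ (SpaceCurve.dualVariety X)) ∧
      ∀ Υ : MvPolynomial (Fin 4) ℂ,
        SpaceCurve.IsMinimalEquation Υ (SpaceCurve.dualVariety X) → Υ.totalDegree = m := by
  open SpaceCurve in
  have hlin : ∀ r, r + 1 = 3 → ∀ v : Fin r → Fin (3 + 1) → ℂ, LinearIndependent ℂ v →
      ∃ k, linForm (v k) ∉ idealOf X := by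
    intro r hr v hv
    by_contra! h
    exact hline (isLine_of_linForm_mem hX hr v hv h)
  obtain ⟨Υ, hΥ0, hΥ⟩ := exists_generator_idealOf_dualVariety hX (by norm_num) hlin
  have hmin := isMinimalEquation_of_idealOf_eq_span (zariskiClosure_dualVariety X) hΥ0 hΥ
  refine ⟨Υ.totalDegree, ?_, ⟨Υ, hmin⟩, fun F hF => hF.totalDegree_eq hmin⟩
  obtain ⟨K, _, _, ξ, hξ, hK, -⟩ := exists_isGenericPoint hX
  rw [idealOf_dualVariety hX (by norm_num) hξ] at hΥ
  have hN : Module.finrank K (conormal (idealOf X) ξ) = 2 :=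
    Nat.succ_injective (finrank_conormal hX hξ hK).2
  have hΥN : Υ ∈ vanishingOn (conormal (idealOf X) ξ) := hΥ ▸ Ideal.mem_span_singleton_self Υ
  have hhom := hmin.1.2.1
  -- `Υ` vanishes at the zero vector of the conormal space, so it is not a nonzero constant.
  obtain ⟨d, hd⟩ : ∃ d, Υ.totalDegree = d + 1 := by
    refine Nat.exists_eq_succ_of_ne_zero fun h => hΥ0 ?_
    rw [MvPolynomial.totalDegree_eq_zero_iff_eq_C] at h
    have h1 := hΥN 0 (Submodule.zero_mem _)
    rw [h, MvPolynomial.aeval_C, map_eq_zero] at h1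
    rw [h, h1, map_zero]
  rw [hd] at hhom ⊢
  obtain ⟨G₁, hG₁, h₁⟩ := exists_generic_centre hξ (by rw [hN]; norm_num)
  obtain ⟨G₂, hG₂, h₂⟩ := exists_forall_linForm_mem hX hline
  obtain ⟨G₃, hG₃, h₃⟩ := exists_generic_section hN hΥ hhom hΥ0
  -- The three factors ensure a centre off X with a conormal vector not orthogonal to it, no plane
  -- containing both X and the centre, and a good plane section. All these conditions are
  -- insensitive to the scalar `c`.
  refine holdsGenerically_of_polynomial (mul_ne_zero (mul_ne_zero hG₁ hG₂) hG₃)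
    fun O c hc hO => ?_
  rw [map_mul, map_mul, mul_ne_zero_iff, mul_ne_zero_iff] at hO
  have hdot : ∀ w : Fin 4 → ℂ, w ⬝ᵥ (c • O.rep) = 0 ↔ w ⬝ᵥ O.rep = 0 := by
    intro w
    rw [dotProduct_smul, smul_eq_zero, or_iff_right hc]
  have hdotK : ∀ a : Fin 4 → K, a ⬝ᵥ (fun i => algebraMap ℂ K ((c • O.rep) i)) = 0 ↔
      a ⬝ᵥ (fun i => algebraMap ℂ K (O.rep i)) = 0 := by
    intro a
    have h : (fun i => algebraMap ℂ K ((c • O.rep) i)) =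
        algebraMap ℂ K c • fun i => algebraMap ℂ K (O.rep i) := by
      funext i
      rw [Pi.smul_apply, Pi.smul_apply, smul_eq_mul, smul_eq_mul, map_mul]
    rw [h, dotProduct_smul, smul_eq_zero, map_eq_zero, or_iff_right hc]
  obtain ⟨hOX, a, ha, hao⟩ := h₁ _ hO.1.1
  obtain ⟨⟨b, hb, hbΥ⟩, hg⟩ := h₃ _ hO.2
  have hOX' : O ∉ X := fun h => hOX (smul_mem_cone (rep_mem_cone.2 h) hc)
  refine ⟨hOX', fun M hM => ⟨isIrreducibleCurve_projection hX hM hOX',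
    hasClass_projection hX hξ hK hM hOX' ⟨a, ha, mt (hdotK a).2 hao⟩
      (fun w hw hwX => mt (hdot w).2 (h₂ _ hO.1.2 w hw hwX)) hhom hΥN
      ⟨⟨b, (hdot b).1 hb, hbΥ⟩, fun g hgd hgN w hw => ?_⟩⟩⟩
  exact hg g hgd (fun a ha hao => hgN a ha ((hdotK a).1 hao)) w ((hdot w).2 hw)
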